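/- A flow network $\mathcal N=(D,s,t,c)$ consists of a finite digraph $D=(V,A)$ without parallel arcs, two distinct vertices $s,t$, and capacities $c:A\to\mathbb N$; it is acyclic if $D$ has no directed cycle. An $(s,t)$-flow is a map $x:A\to\mathbb N$ with $x(a)\le c(a)$ for every arc $a$ and with inflow equal to outflow at every vertex other than $s,t$; its value is $\sum_{u\in N^+(s)}x(su)$. A path-flow sends $r\in\mathbb N$ units along every arc of one directed $(s,t)$-path and $0$ along all other arcs. The problem $p$-Vertex-Decomposable-Max-Flow (respectively $p$-Arc-Decomposable-Max-Flow) asks, given $\mathcal N$ and an integer $p\ge 0$, for the maximum value of an $(s,t)$-flow that is the sum of at most $p$ path-flows along pairwise vertex-disjoint paths, i.e. paths that share no arc and no vertex other than $s,t$ (respectively, along pairwise arc-disjoint paths). Write $n=|V|$. Running times count the steps of a unit-cost random access machine over $\mathbb N$ with addition, truncated subtraction, indirect addressing and zero tests, whose input is $n$, $p$, $s$, $t$, the adjacency matrix of $D$ and the matrix of capacities. **Theorem.** There are a single algorithm, which takes $(\mathcal N,p)$ as its input, and a computable function $f:\mathbb N\to\mathbb N$ such that the algorithm solves $p$-Vertex-Decomposable-Max-Flow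 on all acyclic networks and all $p$ in time $O\left(n^{f(p)}\right)$, with an absolute implied constant; that is, it is an XP-algorithm for the parameter $p$. The same holds for $p$-Arc-Decomposable-Max-Flow on acyclic networks, with an algorithm and a computable function $f$ of its own. -/

import Mathlib

/-!
# Maximum flows decomposable into few disjoint path-flows, and a unit-cost RAM
-/

/-- A flow network `(D, s, t, c)`: a digraph (no parallel arcs), a source, a different sink, and
natural-number capacities on the arcs. Only the values `cap u v` with `D.Adj u v` matter. -/
structure FlowNetwork (V : Type*) where
  D : Digraph V
  s : V
  t : V
  s_ne_t : s ≠ t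
  cap : V → V → ℕ

namespace FlowNetwork

variable {V : Type*}

/-- The network has no directed cycle (loops and 2-cycles are directed cycles). -/
def Acyclic (N : FlowNetwork V) : Prop :=
  ∀ v, ¬ Relation.TransGen N.D.Adj v v

/-- `x` is an integral `(s,t)`-flow: it lives on the arcs, respects the capacities, and is
conserved at every vertex other than `s` and `t`. -/
def IsFlow [Fintype V] (N : FlowNetwork V) (x : V → V → ℕ) : Prop :=
  (∀ u v, ¬ N.D.Adj u v → x u v = 0) ∧
  (∀ u v, N.D.Adj u v → x u v ≤ N.cap u v) ∧
  (∀ v, v ≠ N.s → v ≠ N.t → ∑ u, x u v = ∑ w, x v w)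

/-- The value of a flow: the total flow on the arcs leaving `s`. -/
def value [Fintype V] (N : FlowNetwork V) (x : V → V → ℕ) : ℕ :=
  ∑ u, x N.s u

/-- The vertex sequence `P` is a directed `(s,t)`-path of the network. -/
def IsPath (N : FlowNetwork V) (P : List V) : Prop :=
  P.head? = some N.s ∧ P.getLast? = some N.t ∧ P.Nodup ∧ P.IsChain N.D.Adj

/-- `uv` is an arc of the path with vertex sequence `P`: `u`, `v` are consecutive in `P`. -/
def IsArcOf (P : List V) (u v : V) : Prop :=
  [u, v] <:+: P

open Classical in
/-- The path-flow that sends `r` units along `P`. -/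
noncomputable def pathFlow (P : List V) (r : ℕ) (u v : V) : ℕ :=
  if IsArcOf P u v then r else 0

/-- Two paths have no arc in common. -/
def ArcDisjoint (P Q : List V) : Prop :=
  ∀ u v, ¬ (IsArcOf P u v ∧ IsArcOf Q u v)

/-- Two `(s,t)`-paths have no arc in common and no vertex in common other than `s` and `t`. -/
def VertexDisjoint (N : FlowNetwork V) (P Q : List V) : Prop :=
  ArcDisjoint P Q ∧ ∀ v, v ∈ P → v ∈ Q → v = N.s ∨ v = N.t

/-- `x` is the arc-wise sum of at most `p` path-flows along `(s,t)`-paths that are pairwise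
related by `R`. -/
def DecomposesInto (N : FlowNetwork V) (R : List V → List V → Prop) (p : ℕ)
    (x : V → V → ℕ) : Prop :=
  ∃ k : ℕ, k ≤ p ∧ ∃ (P : Fin k → List V) (r : Fin k → ℕ),
    (∀ i, N.IsPath (P i)) ∧
    (∀ i j, i ≠ j → R (P i) (P j)) ∧
    (∀ u v, x u v = ∑ i, pathFlow (P i) (r i) u v)

/-- `a` is the maximum value of a flow of `N` that can be decomposed into at most `p` pairwise
vertex-disjoint path-flows. -/
def IsVertexDecomposableMax [Fintype V] (N : FlowNetwork V) (p a : ℕ) : Prop :=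
  IsGreatest {b | ∃ x, N.IsFlow x ∧ N.DecomposesInto N.VertexDisjoint p x ∧ N.value x = b} a

/-- `a` is the maximum value of a flow of `N` that can be decomposed into at most `p` pairwise
arc-disjoint path-flows. -/
def IsArcDecomposableMax [Fintype V] (N : FlowNetwork V) (p a : ℕ) : Prop :=
  IsGreatest {b | ∃ x, N.IsFlow x ∧ N.DecomposesInto ArcDisjoint p x ∧ N.value x = b} a

end FlowNetwork

/-! ## Random access machine with unit costs

A program is a finite term, so it uses a fixed finite set of registers. The operations are those
of the usual RAM without multiplication: constants, addition, (truncated) subtraction, indirect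
reading and writing of the memory, and zero tests. -/

namespace RAM

structure State where
  reg : ℕ → ℕ
  mem : ℕ → ℕ

/-- Set register `i` to `a`. -/
def State.setReg (σ : State) (i a : ℕ) : State :=
  { σ with reg := Function.update σ.reg i a }

/-- Set the memory cell with address `i` to `a`. -/
def State.setMem (σ : State) (i a : ℕ) : State :=
  { σ with mem := Function.update σ.mem i a }

inductive Prog where
  /-- `R i := k` -/
  | const (i k : ℕ)
  /-- `R i := R j + R k` -/
  | add (i j k : ℕ)
  /-- `R i := R j - R k`, truncated at `0` -/
  | sub (i j k : ℕ)
  /-- `R i := M[R j]` -/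
  | load (i j : ℕ)
  /-- `M[R i] := R j` -/
  | store (i j : ℕ)
  /-- first `a`, then `b` -/
  | seq (a b : Prog)
  /-- if `R i ≠ 0` then `a` else `b` -/
  | ite (i : ℕ) (a b : Prog)
  /-- while `R i ≠ 0` do `a` -/
  | loop (i : ℕ) (a : Prog)

/-- `Runs P σ τ k`: started in state `σ`, the program `P` halts in state `τ` after exactly `k`
steps. Every elementary operation and every evaluation of a test is one step. -/
inductive Runs : Prog → State → State → ℕ → Prop
  | const (i k : ℕ) (σ : State) : Runs (.const i k) σ (σ.setReg i k) 1
  | add (i j k : ℕ) (σ : State) : Runs (.add i j k) σ (σ.setReg i (σ.reg j + σ.reg k)) 1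
  | sub (i j k : ℕ) (σ : State) : Runs (.sub i j k) σ (σ.setReg i (σ.reg j - σ.reg k)) 1
  | load (i j : ℕ) (σ : State) : Runs (.load i j) σ (σ.setReg i (σ.mem (σ.reg j))) 1
  | store (i j : ℕ) (σ : State) : Runs (.store i j) σ (σ.setMem (σ.reg i) (σ.reg j)) 1
  | seq {a b : Prog} {σ τ υ : State} {k l : ℕ} :
      Runs a σ τ k → Runs b τ υ l → Runs (.seq a b) σ υ (k + l)
  | ite_true {i : ℕ} {a b : Prog} {σ τ : State} {k : ℕ} :
      σ.reg i ≠ 0 → Runs a σ τ k → Runs (.ite i a b) σ τ (k + 1)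
  | ite_false {i : ℕ} {a b : Prog} {σ τ : State} {k : ℕ} :
      σ.reg i = 0 → Runs b σ τ k → Runs (.ite i a b) σ τ (k + 1)
  | loop_true {i : ℕ} {a : Prog} {σ τ υ : State} {k l : ℕ} :
      σ.reg i ≠ 0 → Runs a σ τ k → Runs (.loop i a) τ υ l → Runs (.loop i a) σ υ (k + l + 1)
  | loop_false {i : ℕ} {a : Prog} {σ : State} :
      σ.reg i = 0 → Runs (.loop i a) σ σ 1

end RAM

namespace FlowNetwork

open Classical in
/-- Entry `(u, v)` of the adjacency matrix, `0` outside of the index range. -/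
noncomputable def adjEntry {n : ℕ} (N : FlowNetwork (Fin n)) (u v : ℕ) : ℕ :=
  if h : u < n ∧ v < n then
    if N.D.Adj ⟨u, h.1⟩ ⟨v, h.2⟩ then 1 else 0
  else 0

open Classical in
/-- Entry `(u, v)` of the capacity matrix, `0` for non-arcs and outside of the index range. -/
noncomputable def capEntry {n : ℕ} (N : FlowNetwork (Fin n)) (u v : ℕ) : ℕ :=
  if h : u < n ∧ v < n then
    if N.D.Adj ⟨u, h.1⟩ ⟨v, h.2⟩ then N.cap ⟨u, h.1⟩ ⟨v, h.2⟩ else 0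
  else 0

/-- The instance `(N, p)` as the initial state of the machine: registers `0, 1, 2, 3` hold
`n`, `p`, `s`, `t`; the memory cells `0, …, n ^ 2 - 1` hold the adjacency matrix and the cells
`n ^ 2, …, 2 * n ^ 2 - 1` the capacity matrix, row by row; everything else is `0`. -/
noncomputable def initialState {n : ℕ} (N : FlowNetwork (Fin n)) (p : ℕ) : RAM.State where
  reg i :=
    if i = 0 then n
    else if i = 1 then p
    else if i = 2 then (N.s : ℕ)
    else if i = 3 then (N.t : ℕ)
    else 0
  mem a :=
    if a < n * n then N.adjEntry (a / n) (a % n)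
    else N.capEntry ((a - n * n) / n) ((a - n * n) % n)

end FlowNetwork

/-- The program `A` solves a maximization problem on acyclic networks (`Sol N p a` says that `a`
is the right answer on the instance `(N, p)`) within `T n p` steps, where `n` is the number of
vertices. The answer is left in register `0`. -/
def SolvesOnAcyclic (A : RAM.Prog)
    (Sol : ∀ n : ℕ, FlowNetwork (Fin n) → ℕ → ℕ → Prop) (T : ℕ → ℕ → ℕ) : Prop :=
  ∀ (n : ℕ) (N : FlowNetwork (Fin n)) (p : ℕ), N.Acyclic →
    ∃ (τ : RAM.State) (k : ℕ), RAM.Runs A (N.initialState p) τ k ∧ k ≤ T n p ∧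
      Sol n N p (τ.reg 0)

/-! ## A small expression language compiled to the machine

A `Code` is a program with a free parameter, the level: at level `d` it leaves its result in
register `d`, keeps the registers below `d` and may use all others as scratch space. -/

namespace RAM

/-! Raising the flow along each path to the capacity of its bottleneck arc keeps the paths and does
not lower the value. So every path needs only a threshold among the at most `n ^ 2` arc capacities,
and it remains to decide for which `p` thresholds there are disjoint paths whose arcs have at least
the respective capacities; threshold `0` stands for an unused path. This is a pebble game in the
spirit of Fortune, Hopcroft and Wyllie. A configuration gives for each pebble the arc just traversed
and the arc whose capacity is its threshold, so there are `(n ^ 4) ^ p` configurations.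

A configuration is winning if the pebbles can be routed to the sink without conflicts. This is a
local condition: the current arcs do not conflict, and every active pebble not yet at the sink can
move to a winning configuration. Necessity is following the routes (`Routable.exists_move`).
Sufficiency (`exists_routable_of_moves`) is where acyclicity matters: no other pebble can later
enter the vertex of the pebble that is first in a topological order. As all pebbles must have a
move, the program never computes such an order. `DecomposesInto.exists_routable` and
`Routable.exists_flow` translate between flows and the game. Routes have total length at most `p *
n`, so `p * n + 1` rounds of marking find all relevant winning configurations.

For the running time, every code gets a bound `(M + 2) ^ k`, with `M` bounding all loops.
Composition adds exponents up to constants, so `k` is absolute (6000, not optimized), and `M = n ^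
(4 * p + 5)` gives an exponent linear in `p`. -/

abbrev Code := ℕ → Prog

/-- The registers below the level `lvl`, which hold the variables that are in scope. -/
structure Ctx where
  lvl : ℕ
  reg : ℕ → ℕ

/-- `Δ` has all variables of `Γ`, with the same values. -/
def Ctx.Le (Γ Δ : Ctx) : Prop :=
  Γ.lvl ≤ Δ.lvl ∧ ∀ j < Γ.lvl, Δ.reg j = Γ.reg j

theorem Ctx.Le.refl (Γ : Ctx) : Γ.Le Γ := ⟨le_rfl, fun _ _ => rfl⟩

theorem Ctx.Le.trans {Γ Δ Θ : Ctx} (h : Γ.Le Δ) (h' : Δ.Le Θ) : Γ.Le Θ :=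
  ⟨h.1.trans h'.1, fun j hj => (h'.2 j (hj.trans_le h.1)).trans (h.2 j hj)⟩

/-- The variable `x` has the value `a`. -/
def Var (Γ : Ctx) (x a : ℕ) : Prop := x < Γ.lvl ∧ Γ.reg x = a

theorem Var.mono {Γ Δ : Ctx} {x a : ℕ} (h : Var Γ x a) (hΓ : Γ.Le Δ) : Var Δ x a :=
  ⟨h.1.trans_le hΓ.1, (hΓ.2 x h.1).trans h.2⟩

/-- In the context `Γ` and with memory `μ`, the code `E` ends with a result and a memory that
satisfy `Q`, after at most `(M + 2) ^ k` steps. -/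
structure Meets (M : ℕ) (Γ : Ctx) (μ : ℕ → ℕ) (E : Code) (Q : ℕ → (ℕ → ℕ) → Prop) (k : ℕ) :
    Prop where
  run : ∀ Δ : Ctx, Γ.Le Δ → ∃ (τ : State) (t : ℕ), Runs (E Δ.lvl) ⟨Δ.reg, μ⟩ τ t ∧
    t ≤ (M + 2) ^ k ∧ (∀ j < Δ.lvl, τ.reg j = Δ.reg j) ∧ Q (τ.reg Δ.lvl) τ.mem

/-- The code `E` evaluates to `v` and leaves the memory as it is. -/
def Ev (M : ℕ) (Γ : Ctx) (μ : ℕ → ℕ) (E : Code) (v : ℕ) (k : ℕ) : Prop :=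
  Meets M Γ μ E (fun a m => a = v ∧ m = μ) k

/-- The code `E` decides the proposition `P`. -/
def Dec (M : ℕ) (Γ : Ctx) (μ : ℕ → ℕ) (E : Code) (P : Prop) (k : ℕ) : Prop :=
  Meets M Γ μ E (fun a m => (a ≠ 0 ↔ P) ∧ m = μ) k

section
variable {M : ℕ} {Γ Δ : Ctx} {μ : ℕ → ℕ} {E F G : Code} {Q R : ℕ → (ℕ → ℕ) → Prop}
  {a b v w k l m : ℕ} {P P' : Prop}

/-! ### Weakening rules and the arithmetic of cost bounds. -/

theorem Meets.mono (h : Meets M Γ μ E Q k) (hΓ : Γ.Le Δ) : Meets M Δ μ E Q k :=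
  ⟨fun Θ hΘ => h.run Θ (hΓ.trans hΘ)⟩

theorem Meets.cost_le (h : Meets M Γ μ E Q k) (hk : k ≤ l) : Meets M Γ μ E Q l := ⟨fun Δ hΔ =>
  let ⟨τ, t, h1, h2, h3⟩ := h.run Δ hΔ
  ⟨τ, t, h1, h2.trans (Nat.pow_le_pow_right (by omega) hk), h3⟩⟩

theorem Meets.imp (h : Meets M Γ μ E Q k) (hQ : ∀ a m, Q a m → R a m) : Meets M Γ μ E R k :=
  ⟨fun Δ hΔ =>
  let ⟨τ, t, h1, h2, h3, h4⟩ := h.run Δ hΔ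
  ⟨τ, t, h1, h2, h3, hQ _ _ h4⟩⟩

theorem Ev.mono (h : Ev M Γ μ E v k) (hΓ : Γ.Le Δ) : Ev M Δ μ E v k := Meets.mono h hΓ

theorem Ev.cost_le (h : Ev M Γ μ E v k) (hk : k ≤ l) : Ev M Γ μ E v l := Meets.cost_le h hk

theorem Dec.cost_le (h : Dec M Γ μ E P k) (hk : k ≤ l) : Dec M Γ μ E P l := Meets.cost_le h hk

theorem Dec.congr (h : Dec M Γ μ E P k) (hP : P ↔ P') : Dec M Γ μ E P' k :=
  Meets.imp h fun _ _ h' => ⟨h'.1.trans hP, h'.2⟩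

/-- For `x, y ≥ 1` one has `x + y + 2 ≤ 4 * x * y`, and `W ^ 2 ≥ 4`. This lets sequential
composition add exponents, so that cost bookkeeping becomes linear arithmetic. -/
theorem pow_add_pow_add_two_le {W : ℕ} (hW : 2 ≤ W) (k l : ℕ) :
    W ^ k + W ^ l + 2 ≤ W ^ (k + l + 2) := by
  have h1 : 1 ≤ W ^ k := Nat.one_le_pow _ _ (by omega)
  have h2 : 1 ≤ W ^ l := Nat.one_le_pow _ _ (by omega)
  have h3 : 4 ≤ W ^ 2 := Nat.pow_le_pow_left hW 2
  have h4 : 1 ≤ W ^ k * W ^ l := Nat.mul_pos h1 h2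
  rw [pow_add, pow_add]
  nlinarith [Nat.mul_le_mul_left (W ^ k * W ^ l) h3]

/-! ### Primitive codes -/

/-- `R i := R j`, for `i ≠ j`. -/
def copy (i j : ℕ) : Prog := .seq (.const i 0) (.add i j i)

theorem runs_copy {i j : ℕ} (h : i ≠ j) (σ : State) :
    Runs (copy i j) σ (σ.setReg i (σ.reg j)) 2 := by
  have := Runs.seq (Runs.const i 0 σ) (Runs.add i j i (σ.setReg i 0))
  simpa [copy, State.setReg, Function.update_of_ne h.symm] using this

def cst (c : ℕ) : Code := fun d => .const d c

def var (x : ℕ) : Code := fun d => copy d x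

def addV (x y : ℕ) : Code := fun d => .add d x y

def subV (x y : ℕ) : Code := fun d => .sub d x y

def loadV (x : ℕ) : Code := fun d => .load d x

def storeV (x y : ℕ) : Code := fun _ => .store x y

def iteV (x : ℕ) (E F : Code) : Code := fun d => .ite x (E d) (F d)

/-- Evaluate `E` to a new variable and go on with `F`. -/
def bind (E : Code) (F : ℕ → Code) : Code := fun d =>
  .seq (E d) (.seq (F d (d + 1)) (copy d (d + 1)))

/-- Starting from `init`, apply `body` to the accumulator and the index for the indices below
the value of the variable `b`, in decreasing order. -/
def loop (b : ℕ) (init : Code) (body : ℕ → ℕ → Code) : Code := fun d =>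
  .seq (init d) (.seq (copy (d + 1) b) (.loop (d + 1)
    (.seq (.const (d + 2) 1) (.seq (.sub (d + 1) (d + 1) (d + 2))
      (.seq (body d (d + 1) (d + 2)) (copy d (d + 2)))))))

theorem Ev.cst (c : ℕ) : Ev M Γ μ (cst c) c 0 := ⟨fun Δ _ =>
  ⟨_, _, Runs.const _ _ _, by simp, fun j hj => by simp [State.setReg, hj.ne],
    by simp [State.setReg]⟩⟩

theorem Var.ev {x : ℕ} (h : Var Γ x a) : Ev M Γ μ (var x) a 1 := by
  refine ⟨fun Δ hΔ => ?_⟩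
  have h' := h.mono hΔ
  refine ⟨_, _, runs_copy h'.1.ne' _, by simp, fun j hj => by simp [State.setReg, hj.ne], ?_⟩
  simp [State.setReg, h'.2]

theorem Ev.addV {x y : ℕ} (h : Var Γ x a) (h' : Var Γ y b) : Ev M Γ μ (addV x y) (a + b) 0 :=
  ⟨fun Δ hΔ => ⟨_, _, Runs.add _ _ _ _, by simp, fun j hj => by simp [State.setReg, hj.ne],
    by simp [State.setReg, (h.mono hΔ).2, (h'.mono hΔ).2]⟩⟩

theorem Ev.subV {x y : ℕ} (h : Var Γ x a) (h' : Var Γ y b) : Ev M Γ μ (subV x y) (a - b) 0 :=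
  ⟨fun Δ hΔ => ⟨_, _, Runs.sub _ _ _ _, by simp, fun j hj => by simp [State.setReg, hj.ne],
    by simp [State.setReg, (h.mono hΔ).2, (h'.mono hΔ).2]⟩⟩

theorem Ev.loadV {x : ℕ} (h : Var Γ x a) : Ev M Γ μ (loadV x) (μ a) 0 :=
  ⟨fun Δ hΔ => ⟨_, _, Runs.load _ _ _, by simp, fun j hj => by simp [State.setReg, hj.ne],
    by simp [State.setReg, (h.mono hΔ).2]⟩⟩

theorem Meets.storeV {x y : ℕ} (h : Var Γ x a) (h' : Var Γ y b) :
    Meets M Γ μ (storeV x y) (fun _ m => m = Function.update μ a b) 0 :=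
  ⟨fun Δ hΔ => ⟨_, _, Runs.store _ _ _, by simp, fun j hj => by simp [State.setMem],
    by simp [State.setMem, (h.mono hΔ).2, (h'.mono hΔ).2]⟩⟩

theorem Meets.iteV {x : ℕ} (h : Var Γ x a) (hE : a ≠ 0 → Meets M Γ μ E Q k)
    (hF : a = 0 → Meets M Γ μ F Q l) : Meets M Γ μ (iteV x E F) Q (k + l + 2) := by
  refine ⟨fun Δ hΔ => ?_⟩
  have hx := (h.mono hΔ).2
  have hb := pow_add_pow_add_two_le (W := M + 2) (by omega) k l
  by_cases ha : a = 0
  · obtain ⟨τ, t, h1, h2, h3⟩ := (hF ha).run Δ hΔ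
    exact ⟨τ, t + 1, Runs.ite_false (by simpa [hx] using ha) h1, by omega, h3⟩
  · obtain ⟨τ, t, h1, h2, h3⟩ := (hE ha).run Δ hΔ
    exact ⟨τ, t + 1, Runs.ite_true (by simpa [hx] using ha) h1, by omega, h3⟩

/-- The continuation runs one level higher, with the result of `E` protected in the register below;
the copy that moves its result down takes two steps. -/
theorem Meets.bind {F : ℕ → Code} (hE : Meets M Γ μ E Q k)
    (hF : ∀ Δ : Ctx, Γ.Le Δ → ∀ x a m, Var Δ x a → Q a m → Meets M Δ m (F x) R l) :
    Meets M Γ μ (bind E F) R (k + l + 2) := by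
  refine ⟨fun Δ hΔ => ?_⟩
  obtain ⟨τ, t, h1, h2, h3, h4⟩ := hE.run Δ hΔ
  have hle : Δ.Le ⟨Δ.lvl + 1, τ.reg⟩ := ⟨Nat.le_succ _, h3⟩
  obtain ⟨υ, u, g1, g2, g3, g4⟩ := (hF ⟨Δ.lvl + 1, τ.reg⟩ (hΔ.trans hle) Δ.lvl _ _
    ⟨Nat.lt_succ_self _, rfl⟩ h4).run _ (Ctx.Le.refl _)
  refine ⟨_, _, Runs.seq h1 (Runs.seq g1 (runs_copy (by omega) _)), ?_, fun j hj => ?_, ?_⟩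
  · have := pow_add_pow_add_two_le (W := M + 2) (by omega) k l
    omega
  · have : j < Δ.lvl + 1 := by omega
    simp [State.setReg, hj.ne, g3 j this, h3 j hj]
  · simpa [State.setReg] using g4

theorem Ev.bind {F : ℕ → Code} (hE : Ev M Γ μ E v k)
    (hF : ∀ Δ : Ctx, Γ.Le Δ → ∀ x, Var Δ x v → Meets M Δ μ (F x) R l) :
    Meets M Γ μ (bind E F) R (k + l + 2) :=
  Meets.bind hE fun Δ hΔ x a m hx h => by
    obtain ⟨rfl, rfl⟩ := h
    exact hF Δ hΔ x hx

/-- `I i` is the invariant when the counter equals `i`; the counter descends from `n`, so it serves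
as its own loop test. The number of passes is at most `M` and therefore only adds a constant to the
exponent. -/
theorem Meets.loop {x n : ℕ} {init : Code} {body : ℕ → ℕ → Code}
    (I : ℕ → ℕ → (ℕ → ℕ) → Prop) (hx : Var Γ x n) (hn : n ≤ M) (h0 : Meets M Γ μ init (I n) k)
    (hbody : ∀ Δ : Ctx, Γ.Le Δ → ∀ y z i a m, i < n → Var Δ y a → Var Δ z i → I (i + 1) a m →
      Meets M Δ m (body y z) (I i) l) :
    Meets M Γ μ (loop x init body) (I 0) (k + l + 8) := by
  refine ⟨fun Δ hΔ => ?_⟩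
  obtain ⟨σ, t, h1, h2, h3, h4⟩ := h0.run Δ hΔ
  have key : ∀ i ≤ n, ∀ σ : State, (∀ j < Δ.lvl, σ.reg j = Δ.reg j) → σ.reg (Δ.lvl + 1) = i →
      I i (σ.reg Δ.lvl) σ.mem → ∃ (τ : State) (t : ℕ), Runs (.loop (Δ.lvl + 1)
        (.seq (.const (Δ.lvl + 2) 1) (.seq (.sub (Δ.lvl + 1) (Δ.lvl + 1) (Δ.lvl + 2))
          (.seq (body Δ.lvl (Δ.lvl + 1) (Δ.lvl + 2)) (copy Δ.lvl (Δ.lvl + 2)))))) σ τ t ∧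
        t ≤ i * ((M + 2) ^ l + 5) + 1 ∧ (∀ j < Δ.lvl, τ.reg j = Δ.reg j) ∧
        I 0 (τ.reg Δ.lvl) τ.mem := by
    intro i
    induction i with
    | zero =>
      intro _ σ hσ hi hI
      exact ⟨σ, 1, Runs.loop_false hi, by omega, hσ, hI⟩
    | succ i ih =>
      intro hin σ hσ hi hI
      let σ' : State := (σ.setReg (Δ.lvl + 2) 1).setReg (Δ.lvl + 1) i
      have hσ' : ∀ j < Δ.lvl + 1, σ'.reg j = σ.reg j := fun j hj => by
        simp [σ', State.setReg, show j ≠ Δ.lvl + 1 by omega, show j ≠ Δ.lvl + 2 by omega]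
      have hle : Δ.Le ⟨Δ.lvl + 2, σ'.reg⟩ :=
        ⟨by simp, fun j hj => (hσ' j (by omega)).trans (hσ j hj)⟩
      obtain ⟨τ, t, g1, g2, g3, g4⟩ := (hbody ⟨Δ.lvl + 2, σ'.reg⟩ (hΔ.trans hle) Δ.lvl (Δ.lvl + 1)
        i _ σ.mem (by omega) ⟨by simp, hσ' _ (by omega)⟩ ⟨by simp, by simp [σ', State.setReg]⟩
        hI).run _ (Ctx.Le.refl _)
      obtain ⟨υ, u, f1, f2, f3, f4⟩ := ih (by omega) (τ.setReg Δ.lvl (τ.reg (Δ.lvl + 2)))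
        (fun j hj => by
          have : j < Δ.lvl + 2 := by omega
          simp [State.setReg, hj.ne, g3 j this, hσ' j (by omega), hσ j hj])
        (by
          have : Δ.lvl + 1 < Δ.lvl + 2 := by omega
          simp [State.setReg, g3 _ this, σ'])
        (by simpa [State.setReg] using g4)
      have r1 := Runs.sub (Δ.lvl + 1) (Δ.lvl + 1) (Δ.lvl + 2) (σ.setReg (Δ.lvl + 2) 1)
      have r2 : (σ.setReg (Δ.lvl + 2) 1).setReg (Δ.lvl + 1)
          ((σ.setReg (Δ.lvl + 2) 1).reg (Δ.lvl + 1) - (σ.setReg (Δ.lvl + 2) 1).reg (Δ.lvl + 2)) =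
          σ' := by
        simp [σ', State.setReg, hi]
      rw [r2] at r1
      refine ⟨υ, _, Runs.loop_true (by omega) (Runs.seq (Runs.const _ _ _) (Runs.seq r1
        (Runs.seq g1 (runs_copy (by omega) _)))) f1, ?_, f3, f4⟩
      rw [Nat.succ_mul]
      omega
  have hc := runs_copy (show Δ.lvl + 1 ≠ x by have := (hx.mono hΔ).1; omega) σ
  have hxn : σ.reg x = n := by
    rw [h3 x (hx.mono hΔ).1, (hx.mono hΔ).2]
  rw [hxn] at hc
  obtain ⟨τ, u, g1, g2, g3, g4⟩ := key n le_rfl (σ.setReg (Δ.lvl + 1) n)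
    (fun j hj => by simp [State.setReg, show j ≠ Δ.lvl + 1 by omega, h3 j hj])
    (by simp [State.setReg]) (by simpa [State.setReg] using h4)
  refine ⟨τ, _, Runs.seq h1 (Runs.seq hc g1), ?_, g3, g4⟩
  have e1 : 1 ≤ (M + 2) ^ l := Nat.one_le_pow _ _ (by omega)
  -- Besides the body, a pass takes 5 steps: the constant, the decrement, the copy (two) and the
  -- test.
  have e2 : n * ((M + 2) ^ l + 5) ≤ (M + 2) ^ (l + 4) := by
    calc n * ((M + 2) ^ l + 5) ≤ (M + 2) * ((M + 2) ^ l * 2 ^ 3) :=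
          Nat.mul_le_mul (by omega) (by omega)
      _ ≤ (M + 2) * ((M + 2) ^ l * (M + 2) ^ 3) :=
          Nat.mul_le_mul le_rfl (Nat.mul_le_mul le_rfl (Nat.pow_le_pow_left (by omega) 3))
      _ = _ := by ring
  have e3 := pow_add_pow_add_two_le (W := M + 2) (by omega) k (l + 4)
  have e4 := pow_add_pow_add_two_le (W := M + 2) (by omega) (k + (l + 4) + 2) 0
  rw [show k + l + 8 = k + (l + 4) + 2 + 0 + 2 by ring]
  omega

/-! ### Arithmetic -/

def add (E F : Code) : Code := bind E fun x => bind F fun y => addV x y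

def sub (E F : Code) : Code := bind E fun x => bind F fun y => subV x y

def load (E : Code) : Code := bind E fun x => loadV x

def store (E F : Code) : Code := bind E fun x => bind F fun y => storeV x y

def ite (C E F : Code) : Code := bind C fun x => iteV x E F

theorem Ev.add (hE : Ev M Γ μ E v k) (hF : Ev M Γ μ F w l) :
    Ev M Γ μ (add E F) (v + w) (k + l + 4) :=
  (hE.bind fun _ hΔ _ hx => (hF.mono hΔ).bind fun _ hΘ _ hy =>
    Ev.addV (hx.mono hΘ) hy).cost_le (by omega)

theorem Ev.sub (hE : Ev M Γ μ E v k) (hF : Ev M Γ μ F w l) :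
    Ev M Γ μ (sub E F) (v - w) (k + l + 4) :=
  (hE.bind fun _ hΔ _ hx => (hF.mono hΔ).bind fun _ hΘ _ hy =>
    Ev.subV (hx.mono hΘ) hy).cost_le (by omega)

theorem Ev.load (hE : Ev M Γ μ E v k) : Ev M Γ μ (load E) (μ v) (k + 2) :=
  (hE.bind fun _ _ _ hx => Ev.loadV hx).cost_le (by omega)

theorem Meets.store (hE : Ev M Γ μ E v k) (hF : Ev M Γ μ F w l) :
    Meets M Γ μ (store E F) (fun _ m => m = Function.update μ v w) (k + l + 4) :=
  (hE.bind fun _ hΔ _ hx => (hF.mono hΔ).bind fun _ hΘ _ hy =>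
    Meets.storeV (hx.mono hΘ) hy).cost_le (by omega)

theorem Meets.ite {C : Code} (hC : Dec M Γ μ C P m) (hE : P → Meets M Γ μ E Q k)
    (hF : ¬ P → Meets M Γ μ F Q l) : Meets M Γ μ (ite C E F) Q (m + k + l + 4) := by
  refine (Meets.bind hC (l := k + l + 2) fun Δ hΔ x a m hx h => ?_).cost_le (by omega)
  obtain ⟨hP, rfl⟩ := h
  refine Meets.iteV hx (fun h => (hE (hP.1 h)).mono hΔ) fun h => (hF ?_).mono hΔ
  rw [← hP]
  simpa using h

theorem Ev.loop {x n : ℕ} {init : Code} {body : ℕ → ℕ → Code} (I : ℕ → ℕ → Prop)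
    (hx : Var Γ x n) (hn : n ≤ M) (h0 : Ev M Γ μ init v k) (hI : I n v)
    (hbody : ∀ Δ : Ctx, Γ.Le Δ → ∀ y z i a, i < n → Var Δ y a → Var Δ z i → I (i + 1) a →
      ∃ b, Ev M Δ μ (body y z) b l ∧ I i b)
    (hw : ∀ a, I 0 a → a = w) :
    Ev M Γ μ (loop x init body) w (k + l + 8) := by
  refine (Meets.loop (fun i a m => I i a ∧ m = μ) hx hn (Meets.imp h0 ?_) ?_).imp ?_
  · rintro a m ⟨rfl, rfl⟩
    exact ⟨hI, rfl⟩
  · rintro Δ hΔ y z i a m hi hy hz ⟨h1, rfl⟩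
    obtain ⟨b, hb, hb'⟩ := hbody Δ hΔ y z i a hi hy hz h1
    refine Meets.imp hb ?_
    rintro c m ⟨rfl, rfl⟩
    exact ⟨hb', rfl⟩
  · rintro a m ⟨h, rfl⟩
    exact ⟨hw a h, rfl⟩

/-! ### Propositional connectives and bounded quantifiers -/

def tt : Code := cst 1

def ff : Code := cst 0

def not (E : Code) : Code := ite E ff tt

def and (E F : Code) : Code := ite E F ff

def or (E F : Code) : Code := ite E tt F

def le (E F : Code) : Code := not (sub E F)

def eq (E F : Code) : Code := and (le E F) (le F E)

def all (x : ℕ) (body : ℕ → Code) : Code := loop x tt fun y z => and (body z) (var y)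

def any (x : ℕ) (body : ℕ → Code) : Code := not (all x fun z => not (body z))

theorem Ev.dec (h : Ev M Γ μ E v k) : Dec M Γ μ E (v ≠ 0) k :=
  Meets.imp h fun a m h => ⟨by rw [h.1], h.2⟩

theorem Dec.tt : Dec M Γ μ tt True 0 := (Ev.cst 1).dec.congr (by simp)

theorem Dec.ff : Dec M Γ μ ff False 0 := (Ev.cst 0).dec.congr (by simp)

/-- Each branch has to be correct only if it is taken. Hence the connectives below are lazy, and
later operands may use the earlier ones as hypotheses. -/
theorem Dec.ite {C : Code} {A B : Prop} (hC : Dec M Γ μ C P m) (hE : P → Dec M Γ μ E A k)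
    (hF : ¬ P → Dec M Γ μ F B l) :
    Dec M Γ μ (ite C E F) ((P ∧ A) ∨ (¬ P ∧ B)) (m + k + l + 4) := by
  by_cases hP : P
  · exact Meets.ite hC (fun h => Meets.imp (hE h) (by simp [hP])) fun h => absurd hP h
  · exact Meets.ite hC (fun h => absurd h hP) fun h => Meets.imp (hF h) (by simp [hP])

theorem Dec.bind {F : ℕ → Code} (hE : Ev M Γ μ E v k)
    (hF : ∀ Δ : Ctx, Γ.Le Δ → ∀ x, Var Δ x v → Dec M Δ μ (F x) P l) :
    Dec M Γ μ (bind E F) P (k + l + 2) := Ev.bind hE hF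

theorem Dec.not (h : Dec M Γ μ E P k) : Dec M Γ μ (not E) (¬ P) (k + 4) :=
  (Dec.ite h (fun _ => Dec.ff) (fun _ => Dec.tt)).congr (by tauto)

theorem Dec.and (h : Dec M Γ μ E P k) (h' : P → Dec M Γ μ F P' l) :
    Dec M Γ μ (and E F) (P ∧ P') (k + l + 4) :=
  (Dec.ite h h' (fun _ => Dec.ff)).congr (by tauto)

theorem Dec.or (h : Dec M Γ μ E P k) (h' : ¬ P → Dec M Γ μ F P' l) :
    Dec M Γ μ (or E F) (P ∨ P') (k + l + 4) :=
  ((Dec.ite h (fun _ => Dec.tt) h').congr (by tauto)).cost_le (by omega)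

theorem Dec.le (hE : Ev M Γ μ E v k) (hF : Ev M Γ μ F w l) :
    Dec M Γ μ (le E F) (v ≤ w) (k + l + 8) :=
  (hE.sub hF).dec.not.congr (by omega)

theorem Dec.eq (hE : Ev M Γ μ E v k) (hF : Ev M Γ μ F w l) :
    Dec M Γ μ (eq E F) (v = w) (2 * k + 2 * l + 20) :=
  (((Dec.le hE hF).and fun _ => Dec.le hF hE).congr (by omega)).cost_le (by omega)

theorem Dec.all {x n : ℕ} {body : ℕ → Code} {S : ℕ → Prop} (hx : Var Γ x n) (hn : n ≤ M)
    (hbody : ∀ Δ : Ctx, Γ.Le Δ → ∀ z i, i < n → Var Δ z i → Dec M Δ μ (body z) (S i) k) :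
    Dec M Γ μ (all x body) (∀ i < n, S i) (k + 13) := by
  refine (Meets.loop (fun i a m => (a ≠ 0 ↔ ∀ j < n, i ≤ j → S j) ∧ m = μ) hx hn
    (Meets.imp (Ev.cst 1) ?_) (l := k + 5) ?_).imp ?_ |>.cost_le (by omega)
  · rintro a m ⟨rfl, rfl⟩
    exact ⟨by simp; omega, rfl⟩
  · rintro Δ hΔ y z i a m hi hy hz ⟨ha, rfl⟩
    have hz' := hbody Δ hΔ z i hi hz
    refine Meets.cost_le (Meets.ite hz' (k := 1) (l := 0) (fun h => Meets.imp hy.ev ?_)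
      fun h => Meets.imp (Ev.cst 0) ?_) (by omega)
    · rintro b m ⟨rfl, rfl⟩
      refine ⟨ha.trans ⟨fun H j hj hij => ?_, fun H j hj hij => H j hj (by omega)⟩, rfl⟩
      rcases hij.eq_or_lt with rfl | hij
      · exact h
      · exact H j hj hij
    · rintro b m ⟨rfl, rfl⟩
      exact ⟨by simpa using ⟨i, hi, le_rfl, h⟩, rfl⟩
  · rintro a m ⟨h, rfl⟩
    exact ⟨by simpa using h, rfl⟩

theorem Dec.any {x n : ℕ} {body : ℕ → Code} {S : ℕ → Prop} (hx : Var Γ x n) (hn : n ≤ M)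
    (hbody : ∀ Δ : Ctx, Γ.Le Δ → ∀ z i, i < n → Var Δ z i → Dec M Δ μ (body z) (S i) k) :
    Dec M Γ μ (any x body) (∃ i < n, S i) (k + 21) :=
  ((Dec.all hx hn fun Δ hΔ z i hi hz => (hbody Δ hΔ z i hi hz).not).not.congr
    (by push Not; rfl)).cost_le (by omega)

/-! ### More arithmetic -/

/-- The arguments are evaluated once, not again in every pass of a loop in `f`. -/
def lift₂ (f : ℕ → ℕ → Code) (E F : Code) : Code := bind E fun x => bind F fun y => f x y

theorem Ev.lift₂ {f : ℕ → ℕ → Code} {u : ℕ} (hE : Ev M Γ μ E v k) (hF : Ev M Γ μ F w l)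
    (hf : ∀ Δ : Ctx, Γ.Le Δ → ∀ x y, Var Δ x v → Var Δ y w → Ev M Δ μ (f x y) u m) :
    Ev M Γ μ (lift₂ f E F) u (k + l + m + 4) :=
  (hE.bind fun _ hΔ _ hx => (hF.mono hΔ).bind fun _ hΘ _ hy =>
    hf _ (hΔ.trans hΘ) _ _ (hx.mono hΘ) hy).cost_le (by omega)

def mul : Code → Code → Code := lift₂ fun x y =>
  loop x (cst 0) fun z _ => add (var z) (var y)

def mod : Code → Code → Code := lift₂ fun x y =>
  loop x (var x) fun z _ => ite (le (var y) (var z)) (sub (var z) (var y)) (var z)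

def div : Code → Code → Code := lift₂ fun x y =>
  loop x (cst 0) fun z _ => ite (le (mul (add (var z) (cst 1)) (var y)) (var x))
    (add (var z) (cst 1)) (var z)

def pow : Code → Code → Code := lift₂ fun x y =>
  loop y (cst 1) fun z _ => mul (var z) (var x)

def sum (x : ℕ) (body : ℕ → Code) : Code := loop x (cst 0) fun y z => add (body z) (var y)

def max (x : ℕ) (body : ℕ → Code) : Code := loop x (cst 0) fun y z =>
  bind (body z) fun u => ite (le (var y) (var u)) (var u) (var y)

theorem Ev.mul (hE : Ev M Γ μ E v k) (hF : Ev M Γ μ F w l) (hv : v ≤ M) :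
    Ev M Γ μ (mul E F) (v * w) (k + l + 18) := by
  refine hE.lift₂ (m := 14) hF fun Θ hΘ x y hx hy => ?_
  refine Ev.loop (k := 0) (l := 6) (fun i a => a + i * w = v * w) hx hv (Ev.cst 0) (by simp)
    (fun Λ hΛ z _ i a hi hz _ h => ⟨_, hz.ev.add (hy.mono hΛ).ev, ?_⟩) (by simp)
  rw [← h]
  ring

theorem Ev.mod (hE : Ev M Γ μ E v k) (hF : Ev M Γ μ F w l) (hv : v ≤ M) (hw : 0 < w) :
    Ev M Γ μ (mod E F) (v % w) (k + l + 40) := by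
  refine hE.lift₂ (m := 36) hF fun Θ hΘ x y hx hy => ?_
  -- Repeated subtraction: `v` passes suffice since `w ≥ 1`, and at `i = 0` the second clause says
  -- that the accumulator is the remainder.
  refine Ev.loop (k := 1) (l := 27) (fun i a => a % w = v % w ∧ a < i + w) hx hv hx.ev
    (by omega) (fun Λ hΛ z _ i a hi hz _ h => ?_) ?_
  · have hy' := hy.mono hΛ
    have hd := Dec.le (M := M) (μ := μ) hy'.ev hz.ev
    by_cases hwa : w ≤ a
    · refine ⟨a - w, Meets.cost_le (Meets.ite hd (fun _ => hz.ev.sub hy'.ev)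
        (fun h => absurd hwa h) (l := 0)) (by omega), ?_, by omega⟩
      rw [← h.1, Nat.mod_eq_sub_mod hwa]
    · exact ⟨a, Meets.cost_le (Meets.ite hd (fun h => absurd h hwa) (fun _ => hz.ev) (k := 0))
        (by omega), h.1, by omega⟩
  · rintro a ⟨h, h'⟩
    rw [← h, Nat.mod_eq_of_lt (by omega)]

/-- The quotient is counted up while the next multiple of `w` does not exceed `v`. The test
multiplies with `a + 1 ≤ v + 1` passes, hence the strict bound `v < M`. -/
theorem Ev.div (hE : Ev M Γ μ E v k) (hF : Ev M Γ μ F w l) (hv : v < M) (hw : 0 < w) :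
    Ev M Γ μ (div E F) (v / w) (k + l + 60) := by
  refine hE.lift₂ (m := 56) hF fun Θ hΘ x y hx hy => ?_
  have hdv : v / w ≤ v := Nat.div_le_self _ _
  have hdiv := fun a => (Nat.le_div_iff_mul_le (x := a) (y := v) hw).symm
  generalize v / w = q at *
  refine Ev.loop (k := 0) (l := 48) (fun i a => a ≤ q ∧ q ≤ a + i) hx hv.le (Ev.cst 0)
    (by omega) (fun Λ hΛ z _ i a hi hz _ h => ?_) (fun a h => by omega)
  have hd := (Dec.le (((hz.ev (M := M) (μ := μ)).add (Ev.cst 1)).mul (hy.mono hΛ).ev (by omega))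
      (hx.mono hΛ).ev).congr (hdiv _)
  by_cases hwa : a + 1 ≤ q
  · exact ⟨a + 1, Meets.cost_le (Meets.ite hd (fun _ => hz.ev.add (Ev.cst 1))
      (fun h => absurd hwa h) (l := 0)) (by omega), by omega⟩
  · exact ⟨a, Meets.cost_le (Meets.ite hd (fun h => absurd h hwa) (fun _ => hz.ev) (k := 0))
      (by omega), by omega⟩

theorem Ev.pow (hE : Ev M Γ μ E v k) (hF : Ev M Γ μ F w l) (hv : 0 < v) (hw : w ≤ M)
    (hM : v ^ w ≤ M) : Ev M Γ μ (pow E F) (v ^ w) (k + l + 32) := by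
  refine hE.lift₂ (m := 28) hF fun Θ hΘ x y hx hy => ?_
  refine Ev.loop (k := 0) (l := 20) (fun i a => a * v ^ i = v ^ w) hy hw (Ev.cst 1) (by simp)
    (fun Λ hΛ z _ i a hi hz _ h => ⟨_, hz.ev.mul (hx.mono hΛ).ev ?_, ?_⟩) (by simp)
  -- The partial product is a loop bound inside `mul`; it is bounded by the final power.
  · refine le_trans (Nat.le_mul_of_pos_right a (pow_pos hv (i + 1))) (h.trans_le hM)
  · rw [← h, pow_succ]
    ring

theorem Ev.sum {x n : ℕ} {body : ℕ → Code} {g : ℕ → ℕ} (hx : Var Γ x n) (hn : n ≤ M)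
    (hbody : ∀ Δ : Ctx, Γ.Le Δ → ∀ z i, i < n → Var Δ z i → Ev M Δ μ (body z) (g i) k) :
    Ev M Γ μ (sum x body) (∑ i ∈ Finset.range n, g i) (k + 13) := by
  refine Ev.loop (k := 0) (l := k + 5)
    (fun i a => a + ∑ j ∈ Finset.range i, g j = ∑ j ∈ Finset.range n, g j) hx hn
    (Ev.cst 0) (by simp)
    (fun Λ hΛ y z i a hi hy hz h => ⟨_, (hbody Λ hΛ z i hi hz).add hy.ev, ?_⟩) (by simp)
    |>.cost_le (by omega)
  rw [← h, Finset.sum_range_succ]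
  ring

theorem Ev.max {x n : ℕ} {body : ℕ → Code} {g : ℕ → ℕ} (hx : Var Γ x n) (hn : n ≤ M)
    (hbody : ∀ Δ : Ctx, Γ.Le Δ → ∀ z i, i < n → Var Δ z i → Ev M Δ μ (body z) (g i) k) :
    Ev M Γ μ (max x body) ((Finset.range n).sup g) (k + 26) := by
  refine Ev.loop (k := 0) (l := k + 18)
    (fun i a => a ⊔ (Finset.range i).sup g = (Finset.range n).sup g) hx hn
    (Ev.cst 0) (by simp)
    (fun Λ hΛ y z i a hi hy hz h => ⟨g i ⊔ a, ?_, ?_⟩) (by simp)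
    |>.cost_le (by omega)
  · refine Ev.bind (l := 16) (hbody Λ hΛ z i hi hz) fun Θ hΘ u hu => ?_
    refine Meets.ite (m := 10) (k := 1) (l := 1) (Dec.le (hy.mono hΘ).ev hu.ev)
      (fun h => ?_) fun h => ?_
    · rw [sup_eq_left.2 h]
      exact hu.ev
    · rw [sup_eq_right.2 (by omega)]
      exact (hy.mono hΘ).ev
  · rw [← h, Finset.range_add_one, Finset.sup_insert, ← sup_assoc, sup_comm (g i)]

end

end RAM

/-! ## A pebble game for disjoint paths -/

namespace FlowNetwork

variable {V : Type*} (N : FlowNetwork V)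

open Classical in
/-- The capacity of an arc, `0` for a pair that is not an arc. -/
noncomputable def wt (u v : V) : ℕ := if N.D.Adj u v then N.cap u v else 0

variable {N} in
theorem adj_of_wt_ne_zero {u v : V} (h : N.wt u v ≠ 0) : N.D.Adj u v := by
  by_contra h'
  exact h (if_neg h')

variable {N} in
theorem Acyclic.wt_self (h : N.Acyclic) (v : V) : N.wt v v = 0 :=
  if_neg fun h' => h v (.single h')

variable {N} in
-- Count the vertices from which `v` can be reached by a nonempty walk. The count grows strictly
-- along an arc `uv`, since `u` reaches `v` but not itself.
theorem Acyclic.exists_rank [Finite V] (h : N.Acyclic) :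
    ∃ rk : V → ℕ, ∀ u v, N.D.Adj u v → rk u < rk v := by
  refine ⟨fun v => {u | Relation.TransGen N.D.Adj u v}.ncard, fun u v huv => ?_⟩
  refine Set.ncard_lt_ncard ⟨fun w hw => hw.tail huv, fun hs => ?_⟩ (Set.toFinite _)
  exact h u (hs (.single huv))

/-- The arcs `e`, `(e.2, w₁)`, `(w₁, w₂)`, … for `L = [w₁, w₂, …]`. -/
def arcsFrom : V × V → List V → List (V × V)
  | e, [] => [e]
  | e, w :: L => e :: arcsFrom (e.2, w) L

/-- After the arc `e`, the vertices of `L` are visited along arcs of capacity at least `r`, and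
the sink is reached. -/
def Route (r : ℕ) : V × V → List V → Prop
  | e, [] => e.2 = N.t
  | e, w :: L => r ≤ N.wt e.2 w ∧ Route r (e.2, w) L

/-- The arcs `a` and `b` cannot be used by different paths. -/
def Conflict (m : Prop) (a b : V × V) : Prop :=
  a.2 = b.2 ∧ a.2 ≠ N.s ∧ (a.1 = b.1 ∨ (m ∧ a.2 ≠ N.t))

/-- Pebbles that have just traversed the arcs `e i` can be moved on to the sink, in at most `k`
moves altogether, such that the pebble `i` uses arcs of capacity at least `r i` only and no
conflicts arise. Pebbles with `r i = 0` are ignored. -/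
def Routable {ι : Type*} [Fintype ι] (m : Prop) (e : ι → V × V) (r : ι → ℕ) (k : ℕ) : Prop :=
  ∃ L : ι → List V, (∀ i, r i ≠ 0 → N.Route (r i) (e i) (L i)) ∧
    (∀ i j, i ≠ j → r i ≠ 0 → r j ≠ 0 → ∀ a ∈ arcsFrom (e i) (L i), ∀ b ∈ arcsFrom (e j) (L j),
      ¬ N.Conflict m a b) ∧ ∑ i, (L i).length ≤ k

theorem mem_arcsFrom_self (e : V × V) (L : List V) : e ∈ arcsFrom e L := by
  cases L <;> simp [arcsFrom]

variable {N}

theorem Conflict.symm {m : Prop} {a b : V × V} (h : N.Conflict m a b) : N.Conflict m b a := by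
  obtain ⟨h1, h2, h3⟩ := h
  refine ⟨h1.symm, h1 ▸ h2, ?_⟩
  rw [← h1]
  exact h3.imp Eq.symm id

/-- A positive threshold forces every step of a route to be an arc, so a pebble never returns to the
rank of its present vertex. -/
theorem Route.rank_lt {rk : V → ℕ} (hrk : ∀ u v, N.D.Adj u v → rk u < rk v) {r : ℕ} (hr : r ≠ 0)
    {L : List V} : ∀ {e : V × V}, N.Route r e L → ∀ b ∈ arcsFrom e L, b = e ∨ rk e.2 < rk b.2 := by
  induction L with
  | nil =>
    intro e _ b hb
    exact .inl (by simpa [arcsFrom] using hb)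
  | cons w L ih =>
    rintro e ⟨h1, h2⟩ b hb
    have hw : rk e.2 < rk w := hrk _ _ (adj_of_wt_ne_zero (by omega))
    rcases List.mem_cons.1 hb with hb | hb
    · exact .inl hb
    · rcases ih h2 b hb with rfl | h
      · exact .inr hw
      · exact .inr (hw.trans h)

theorem Route.rank_le {rk : V → ℕ} (hrk : ∀ u v, N.D.Adj u v → rk u < rk v) {r : ℕ} (hr : r ≠ 0)
    {L : List V} : ∀ {e : V × V}, N.Route r e L → rk e.2 ≤ rk N.t := by
  induction L with
  | nil => exact fun h => (congrArg rk h).le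
  | cons w L ih =>
    rintro e ⟨h1, h2⟩
    exact (hrk _ w (adj_of_wt_ne_zero (by omega))).le.trans (ih h2)

/-! ### Local characterization of routable positions. -/

section game

variable {ι : Type*} [Fintype ι] [DecidableEq ι] {m : Prop} {e : ι → V × V} {r : ι → ℕ} {k : ℕ}

omit [DecidableEq ι] in
theorem Routable.not_conflict (h : N.Routable m e r k) {i j : ι} (hij : i ≠ j) (hi : r i ≠ 0)
    (hj : r j ≠ 0) : ¬ N.Conflict m (e i) (e j) := by
  obtain ⟨L, -, h2, -⟩ := h
  exact h2 i j hij hi hj _ (mem_arcsFrom_self _ _) _ (mem_arcsFrom_self _ _)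

/-- The pebble takes the first step of its own route. All lists of arcs only shrink, so no conflict
is created. -/
theorem Routable.exists_move (h : N.Routable m e r k) {i : ι} (hi : r i ≠ 0)
    (ht : (e i).2 ≠ N.t) : 0 < k ∧ ∃ v, r i ≤ N.wt (e i).2 v ∧
      N.Routable m (Function.update e i ((e i).2, v)) r (k - 1) := by
  obtain ⟨L, h1, h2, h3⟩ := h
  obtain ⟨v, K, hL⟩ : ∃ v K, L i = v :: K := by
    have := h1 i hi
    cases hL : L i with
    | nil => rw [hL] at this; exact absurd this ht
    | cons v K => exact ⟨v, K, rfl⟩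
  have hRi := h1 i hi
  rw [hL] at hRi
  have hsub : ∀ j, ∀ a ∈ arcsFrom (Function.update e i ((e i).2, v) j) (Function.update L i K j),
      a ∈ arcsFrom (e j) (L j) := by
    intro j a ha
    rcases eq_or_ne j i with rfl | hji
    · rw [Function.update_self, Function.update_self] at ha
      rw [hL]
      exact List.mem_cons_of_mem _ ha
    · rwa [Function.update_of_ne hji, Function.update_of_ne hji] at ha
  have hsum : ∑ j, (L j).length = ∑ j, (Function.update L i K j).length + 1 := by
    rw [← Finset.add_sum_erase _ _ (Finset.mem_univ i),
      ← Finset.add_sum_erase _ (fun j => (Function.update L i K j).length) (Finset.mem_univ i),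
      hL, Function.update_self, List.length_cons]
    have : ∑ j ∈ Finset.univ.erase i, (Function.update L i K j).length =
        ∑ j ∈ Finset.univ.erase i, (L j).length := Finset.sum_congr rfl fun j hj => by
      rw [Function.update_of_ne (Finset.ne_of_mem_erase hj)]
    omega
  refine ⟨by omega, v, hRi.1, Function.update L i K, fun j hj => ?_, fun j l hjl hj hl a ha b hb =>
    h2 j l hjl hj hl a (hsub j a ha) b (hsub l b hb), by omega⟩
  rcases eq_or_ne j i with rfl | hji
  · rw [Function.update_self, Function.update_self]
    exact hRi.2
  · rw [Function.update_of_ne hji, Function.update_of_ne hji]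
    exact h1 j hj

/-- It is enough that *every* pebble can make a good move: the path of a pebble that is first in
a topological order cannot be blocked by the future of the others. -/
theorem exists_routable_of_moves [Finite V] (hN : N.Acyclic)
    (hc : ∀ i j, i ≠ j → r i ≠ 0 → r j ≠ 0 → ¬ N.Conflict m (e i) (e j))
    (hm : ∀ i, r i ≠ 0 → (e i).2 ≠ N.t → ∃ v, r i ≤ N.wt (e i).2 v ∧
      ∃ k, N.Routable m (Function.update e i ((e i).2, v)) r k) : ∃ k, N.Routable m e r k := by
  obtain ⟨rk, hrk⟩ := hN.exists_rank
  by_cases H : ∃ i, r i ≠ 0 ∧ (e i).2 ≠ N.t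
  -- Only the move of a pebble of least rank is used; its route is the one after the move, with the
  -- new vertex prepended.
  · obtain ⟨i, ⟨hi, hit⟩, hmin⟩ := Set.exists_min_image {i | r i ≠ 0 ∧ (e i).2 ≠ N.t}
      (fun i => rk (e i).2) (Set.toFinite _) H
    obtain ⟨v, hv, k, L, h1, h2, h3⟩ := hm i hi hit
    have hLi := h1 i hi
    rw [Function.update_self] at hLi
    have hRi : N.Route (r i) (e i) (v :: L i) := ⟨hv, hLi⟩
    have hiv : rk (e i).2 < rk v := hrk _ _ (adj_of_wt_ne_zero (by omega))
    have hlt : rk (e i).2 < rk N.t := hiv.trans_le (hLi.rank_le hrk hi)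
    have hLj : ∀ j, j ≠ i → r j ≠ 0 → N.Route (r j) (e j) (L j) := fun j hji hj => by
      simpa [Function.update_of_ne hji] using h1 j hj
    -- The only arc added is `e i`. A conflict with it needs an arc with the same head, but all
    -- later heads of another pebble `j` have rank above `(e j).2`, hence above `(e i).2`.
    have key : ∀ j, j ≠ i → r j ≠ 0 → ∀ a ∈ arcsFrom (e i) (v :: L i),
        ∀ b ∈ arcsFrom (e j) (L j), ¬ N.Conflict m a b := by
      intro j hji hj a ha b hb
      rcases List.mem_cons.1 ha with rfl | ha
      · rcases (hLj j hji hj).rank_lt hrk hj b hb with rfl | hlt'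
        · exact hc i j hji.symm hi hj
        · intro hab
          have hle : rk (e i).2 ≤ rk (e j).2 := by
            -- Pebbles at the sink took no part in the minimum, but the route of `i` ends there, so
            -- their rank is larger as well.
            by_cases hjt : (e j).2 = N.t
            · rw [hjt]; exact hlt.le
            · exact hmin j ⟨hj, hjt⟩
          rw [← hab.1] at hlt'
          omega
      · refine h2 i j hji.symm hi hj a ?_ b ?_
        · rwa [Function.update_self]
        · rwa [Function.update_of_ne hji]
    refine ⟨_, Function.update L i (v :: L i), fun j hj => ?_, fun j l hjl hj hl => ?_, le_rfl⟩
    · rcases eq_or_ne j i with rfl | hji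
      · rwa [Function.update_self]
      · rw [Function.update_of_ne hji]
        exact hLj j hji hj
    · rcases eq_or_ne j i with rfl | hji
      · rw [Function.update_self, Function.update_of_ne hjl.symm]
        exact key l hjl.symm hl
      · rcases eq_or_ne l i with rfl | hli
        · rw [Function.update_self, Function.update_of_ne hji]
          exact fun a ha b hb hab => key j hji hj b hb a ha hab.symm
        · rw [Function.update_of_ne hji, Function.update_of_ne hli]
          have := h2 j l hjl hj hl
          rwa [Function.update_of_ne hji, Function.update_of_ne hli] at this
  · push Not at H
    refine ⟨_, fun _ => [], fun i hi => H i hi, fun i j hij hi hj a ha b hb => ?_, le_rfl⟩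
    rw [List.mem_singleton.1 ha, List.mem_singleton.1 hb]
    exact hc i j hij hi hj

end game

/-! ### Path-flows -/

section pathFlow

variable {P Q : List V} {u v a b : V} {L : List V}

theorem isArcOf_cons_cons : IsArcOf (a :: b :: L) u v ↔ (u = a ∧ v = b) ∨ IsArcOf (b :: L) u v := by
  simp [IsArcOf, List.infix_cons_iff]

theorem not_isArcOf_singleton : ¬ IsArcOf [a] u v := by
  simp [IsArcOf, List.infix_cons_iff]

theorem IsArcOf.mem_left (h : IsArcOf P u v) : u ∈ P := h.subset (by simp)

theorem IsArcOf.mem_right (h : IsArcOf P u v) : v ∈ P := h.subset (by simp)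

theorem pathFlow_cons_cons [DecidableEq V] (h : a ∉ b :: L) (r : ℕ) (u v : V) :
    pathFlow (a :: b :: L) r u v = (if u = a ∧ v = b then r else 0) + pathFlow (b :: L) r u v := by
  classical
  unfold pathFlow
  rw [isArcOf_cons_cons]
  by_cases h1 : u = a ∧ v = b
  · have : ¬ IsArcOf (b :: L) u v := fun h' => h (h1.1 ▸ h'.mem_left)
    simp only [h1]
    simp
    intro h2
    exact absurd (h1.1 ▸ h1.2 ▸ h2) this
  · simp [h1]

/-- On a path without repetitions every vertex but the last is left by exactly one arc. Together
with the count of entering arcs this gives conservation. -/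
theorem sum_pathFlow_right [Fintype V] [DecidableEq V] (hP : P.Nodup) (r : ℕ) (u : V) :
    ∑ v, pathFlow P r u v = if u ∈ P.dropLast then r else 0 := by
  induction P with
  | nil => simp [pathFlow, IsArcOf]
  | cons a P ih =>
    cases P with
    | nil => simp [pathFlow, not_isArcOf_singleton]
    | cons b L =>
      have ha := (List.nodup_cons.1 hP).1
      simp_rw [pathFlow_cons_cons ha, Finset.sum_add_distrib, ih (List.nodup_cons.1 hP).2]
      have ha' : a ∉ (b :: L).dropLast := fun h => ha (List.dropLast_subset _ h)
      rw [List.dropLast_cons_cons]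
      by_cases hu : u = a
      · subst hu
        simp [ha']
      · simp [hu]

theorem sum_pathFlow_left [Fintype V] [DecidableEq V] (hP : P.Nodup) (r : ℕ) (v : V) :
    ∑ u, pathFlow P r u v = if v ∈ P.tail then r else 0 := by
  induction P with
  | nil => simp [pathFlow, IsArcOf]
  | cons a P ih =>
    cases P with
    | nil => simp [pathFlow, not_isArcOf_singleton]
    | cons b L =>
      have hb := (List.nodup_cons.1 (List.nodup_cons.1 hP).2).1
      simp_rw [pathFlow_cons_cons (List.nodup_cons.1 hP).1, Finset.sum_add_distrib,
        ih (List.nodup_cons.1 hP).2]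
      by_cases hv : v = b
      · subst hv
        simp [hb]
      · by_cases hL : v ∈ L <;> simp [hv, hL]

theorem IsPath.eq_cons (h : N.IsPath P) : ∃ L, P = N.s :: L := by
  obtain ⟨h, -⟩ := h
  cases P with
  | nil => simp at h
  | cons a L => exact ⟨L, by simpa using h⟩

theorem IsPath.eq_concat (h : N.IsPath P) : P = P.dropLast ++ [N.t] :=
  (List.dropLast_append_getLast? _ h.2.1).symm

theorem IsPath.mem_dropLast (h : N.IsPath P) (ht : v ≠ N.t) : v ∈ P.dropLast ↔ v ∈ P := by
  conv_rhs => rw [h.eq_concat]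
  simp [ht]

theorem IsPath.mem_tail (h : N.IsPath P) (hs : v ≠ N.s) : v ∈ P.tail ↔ v ∈ P := by
  obtain ⟨L, rfl⟩ := h.eq_cons
  simp [hs]

theorem IsPath.sum_pathFlow_source [Fintype V] (h : N.IsPath P) (r : ℕ) :
    ∑ v, pathFlow P r N.s v = r := by
  classical
  rw [sum_pathFlow_right h.2.2.1, if_pos]
  rw [h.mem_dropLast N.s_ne_t]
  obtain ⟨L, rfl⟩ := h.eq_cons
  simp

theorem IsArcOf.adj {A : V → V → Prop} (hP : P.IsChain A) (h : IsArcOf P u v) : A u v := by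
  have := hP.infix h
  simpa using this

/-- Two paths do not share arcs, nor inner vertices if `m` holds. -/
def Apart (N : FlowNetwork V) (m : Prop) (P Q : List V) : Prop :=
  ArcDisjoint P Q ∧ (m → ∀ v, v ∈ P → v ∈ Q → v = N.s ∨ v = N.t)

/-- By arc-disjointness at most one path-flow lives on a given arc, so capacities can be checked
path by path. -/
theorem exists_flow_of_paths [Fintype V] {ι : Type*} [Fintype ι] {m : Prop} {p : ℕ}
    (hp : Fintype.card ι ≤ p) (P : ι → List V) (r : ι → ℕ) (hP : ∀ i, N.IsPath (P i))
    (hd : ∀ i j, i ≠ j → N.Apart m (P i) (P j))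
    (hr : ∀ i u v, IsArcOf (P i) u v → r i ≤ N.wt u v) :
    ∃ x, N.IsFlow x ∧ N.DecomposesInto (N.Apart m) p x ∧ N.value x = ∑ i, r i := by
  classical
  refine ⟨fun u v => ∑ i, pathFlow (P i) (r i) u v, ⟨fun u v huv => ?_, fun u v huv => ?_,
    fun v hs ht => ?_⟩, ⟨Fintype.card ι, hp, fun i => P ((Fintype.equivFin ι).symm i),
    fun i => r ((Fintype.equivFin ι).symm i), fun i => hP _, fun i j hij => hd _ _ ?_,
    fun u v => ?_⟩, ?_⟩
  · exact Finset.sum_eq_zero fun i _ => if_neg fun h => huv (h.adj (hP i).2.2.2)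
  · change ∑ i, pathFlow (P i) (r i) u v ≤ _
    by_cases H : ∃ i, IsArcOf (P i) u v
    · obtain ⟨i, hi⟩ := H
      rw [Finset.sum_eq_single i]
      · have := hr i u v hi
        rw [wt, if_pos huv] at this
        rwa [pathFlow, if_pos hi]
      · exact fun j _ hji => if_neg fun hj => (hd j i hji).1 u v ⟨hj, hi⟩
      · simp
    · push Not at H
      exact (Finset.sum_eq_zero fun i _ => if_neg (H i)).le.trans (Nat.zero_le _)
  · rw [Finset.sum_comm, Finset.sum_comm (s := Finset.univ (α := V))]
    refine Finset.sum_congr rfl fun i _ => ?_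
    rw [sum_pathFlow_left (hP i).2.2.1, sum_pathFlow_right (hP i).2.2.1]
    simp [(hP i).mem_tail hs, (hP i).mem_dropLast ht]
  · simpa using hij
  · exact (Equiv.sum_comp (Fintype.equivFin ι).symm fun i => pathFlow (P i) (r i) u v).symm
  · rw [value, Finset.sum_comm]
    exact Finset.sum_congr rfl fun i _ => (hP i).sum_pathFlow_source _

end pathFlow

/-! ### From the game to flows and back -/

theorem Route.isChain {r : ℕ} {L : List V} : ∀ {e : V × V}, N.Route r e L →
    (e.2 :: L).IsChain (fun u v => r ≤ N.wt u v) ∧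
      (e.2 :: L).getLast? = some N.t := by
  induction L with
  | nil => exact fun h => ⟨by simp, congrArg some h⟩
  | cons w L ih =>
    rintro e ⟨h1, h2⟩
    obtain ⟨h3, h4⟩ := ih h2
    exact ⟨List.isChain_cons_cons.2 ⟨h1, h3⟩, by simpa using h4⟩

theorem mem_arcsFrom_of_isArcOf {u v : V} {L : List V} : ∀ {e : V × V}, IsArcOf (e.2 :: L) u v →
    (u, v) ∈ arcsFrom e L := by
  induction L with
  | nil => exact fun h => absurd h not_isArcOf_singleton
  | cons w L ih =>
    intro e h
    rcases isArcOf_cons_cons.1 h with ⟨rfl, rfl⟩ | h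
    · exact List.mem_cons_of_mem _ (mem_arcsFrom_self _ _)
    · exact List.mem_cons_of_mem _ (ih h)

theorem isArcOf_of_mem_arcsFrom {a : V × V} {L : List V} : ∀ {e : V × V}, a ∈ arcsFrom e L →
    a = e ∨ IsArcOf (e.2 :: L) a.1 a.2 := by
  induction L with
  | nil => exact fun h => .inl (by simpa [arcsFrom] using h)
  | cons w L ih =>
    intro e h
    rcases List.mem_cons.1 h with h | h
    · exact .inl h
    · rw [isArcOf_cons_cons]
      rcases ih h with rfl | h
      · exact .inr (.inl ⟨rfl, rfl⟩)
      · exact .inr (.inr h)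

theorem exists_isArcOf_of_mem {v : V} {L : List V} : ∀ {a : V}, v ∈ L →
    ∃ u, IsArcOf (a :: L) u v := by
  induction L with
  | nil => simp
  | cons w L ih =>
    intro a h
    simp_rw [isArcOf_cons_cons]
    rcases List.mem_cons.1 h with rfl | h
    · exact ⟨a, .inl ⟨rfl, rfl⟩⟩
    · obtain ⟨u, hu⟩ := ih (a := w) h
      exact ⟨u, .inr hu⟩

/-- Ranks increase along routes, so these are paths and never re-enter `s`; thus it does no harm
that `Conflict` ignores arcs into `s`. A common inner vertex shows up as two arcs with the same
head. Pebbles with threshold `0` are dropped and do not change the sum. -/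
theorem Routable.exists_flow [Fintype V] (hN : N.Acyclic) {m : Prop} {p k : ℕ}
    {e : Fin p → V × V} {r : Fin p → ℕ} (h : N.Routable m e r k)
    (hs : ∀ i, r i ≠ 0 → (e i).2 = N.s) :
    ∃ x, N.IsFlow x ∧ N.DecomposesInto (N.Apart m) p x ∧ N.value x = ∑ i, r i := by
  classical
  obtain ⟨rk, hrk⟩ := hN.exists_rank
  obtain ⟨L, h1, h2, -⟩ := h
  have hch : ∀ i, r i ≠ 0 → (N.s :: L i).IsChain (fun u v => r i ≤ N.wt u v) ∧
      (N.s :: L i).getLast? = some N.t := fun i hi => by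
    rw [← hs i hi]
    exact (h1 i hi).isChain
  have hadj : ∀ i, r i ≠ 0 → (N.s :: L i).IsChain N.D.Adj := fun i hi =>
    (hch i hi).1.imp fun u v huv => adj_of_wt_ne_zero (by omega)
  have hnd : ∀ i, r i ≠ 0 → (N.s :: L i).Pairwise (fun u v => rk u < rk v) := fun i hi => by
    have : IsTrans V (fun u v => rk u < rk v) := ⟨fun _ _ _ => lt_trans⟩
    exact List.isChain_iff_pairwise.1 ((hadj i hi).imp hrk)
  have harc : ∀ i, r i ≠ 0 → ∀ u v, IsArcOf (N.s :: L i) u v → (u, v) ∈ arcsFrom (e i) (L i) ∧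
      v ≠ N.s := fun i hi u v huv => by
    refine ⟨mem_arcsFrom_of_isArcOf (by rwa [hs i hi]), ?_⟩
    rintro rfl
    have h3 := hrk _ _ (huv.adj (hadj i hi))
    rcases List.mem_cons.1 huv.mem_left with rfl | hu
    · exact lt_irrefl _ h3
    · exact lt_asymm h3 ((List.pairwise_cons.1 (hnd i hi)).1 u hu)
  have hap : ∀ i j, i ≠ j → r i ≠ 0 → r j ≠ 0 → N.Apart m (N.s :: L i) (N.s :: L j) := by
    intro i j hij hi hj
    refine ⟨fun u v ⟨hu, hv⟩ => ?_, fun hm v hvi hvj => ?_⟩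
    · exact h2 i j hij hi hj _ (harc i hi u v hu).1 _ (harc j hj u v hv).1
        ⟨rfl, (harc i hi u v hu).2, .inl rfl⟩
    · by_contra! hv
      obtain ⟨u, hu⟩ := exists_isArcOf_of_mem (a := N.s) ((List.mem_cons.1 hvi).resolve_left hv.1)
      obtain ⟨w, hw⟩ := exists_isArcOf_of_mem (a := N.s) ((List.mem_cons.1 hvj).resolve_left hv.1)
      exact h2 i j hij hi hj _ (harc i hi u v hu).1 _ (harc j hj w v hw).1
        ⟨rfl, hv.1, .inr ⟨hm, hv.2⟩⟩
  have hpath : ∀ i, r i ≠ 0 → N.IsPath (N.s :: L i) := fun i hi =>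
    ⟨rfl, (hch i hi).2, (hnd i hi).imp fun {u v} huv => by rintro rfl; exact lt_irrefl _ huv,
      hadj i hi⟩
  obtain ⟨x, hx1, hx2, hx3⟩ := exists_flow_of_paths (N := N) (m := m)
    (ι := {i : Fin p // r i ≠ 0}) (p := p)
    ((Fintype.card_subtype_le _).trans (Fintype.card_fin p).le) (fun i => N.s :: L i)
    (fun i => r i) (fun i => hpath i i.2)
    (fun i j hij => hap i j (fun h => hij (Subtype.ext h)) i.2 j.2)
    (fun i u v huv => huv.adj (A := fun u v => r i ≤ N.wt u v) (hch i i.2).1)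
  refine ⟨x, hx1, hx2, hx3.trans ?_⟩
  rw [← Finset.sum_filter_ne_zero (f := r)]
  exact (Finset.sum_subtype _ (by simp) r).symm

theorem route_of_isChain {r : ℕ} {L : List V} : ∀ {e : V × V},
    (∀ u v, IsArcOf (e.2 :: L) u v → r ≤ N.wt u v) → (e.2 :: L).getLast? = some N.t →
    N.Route r e L := by
  induction L with
  | nil =>
    intro e _ h
    simpa [Route] using h
  | cons w L ih =>
    intro e h h'
    refine ⟨h _ _ (isArcOf_cons_cons.2 (.inl ⟨rfl, rfl⟩)), ih (fun u v huv => h u v ?_) ?_⟩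
    · exact isArcOf_cons_cons.2 (.inr huv)
    · simpa using h'

/-- A path has an arc of minimum capacity. -/
theorem IsPath.exists_bottleneck {P : List V} (h : N.IsPath P) :
    ∃ u v, IsArcOf P u v ∧ ∀ u' v', IsArcOf P u' v' → N.wt u v ≤ N.wt u' v' := by
  have hne : {a : V × V | IsArcOf P a.1 a.2}.Nonempty := by
    obtain ⟨L, rfl⟩ := h.eq_cons
    cases L with
    | nil => exact absurd (by simpa using h.2.1) N.s_ne_t
    | cons w L => exact ⟨(N.s, w), isArcOf_cons_cons.2 (.inl ⟨rfl, rfl⟩)⟩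
  obtain ⟨a, ha, hmin⟩ := exists_minimal_of_wellFoundedLT
    (fun c => ∃ a : V × V, IsArcOf P a.1 a.2 ∧ N.wt a.1 a.2 = c) ⟨_, _, hne.some_mem, rfl⟩
  obtain ⟨⟨u, v⟩, h1, h2⟩ := ha
  refine ⟨u, v, h1, fun u' v' h' => ?_⟩
  by_contra! hlt
  have := hmin ⟨(u', v'), h', rfl⟩ (h2 ▸ hlt.le)
  exact absurd (h2.le.trans this) (by simpa using hlt)

/-- Each amount is replaced by the bottleneck capacity of its path, so thresholds can be named by
arcs. -/
theorem DecomposesInto.exists_routable [Fintype V] (hN : N.Acyclic) {m : Prop} {p : ℕ}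
    {x : V → V → ℕ} (hx : N.IsFlow x) (h : N.DecomposesInto (N.Apart m) p x) :
    ∃ a : Fin p → V × V,
      N.Routable m (fun _ => (N.s, N.s)) (fun i => N.wt (a i).1 (a i).2) (p * Fintype.card V) ∧
      N.value x ≤ ∑ i, N.wt (a i).1 (a i).2 := by
  classical
  obtain ⟨k, hk, P, r, hP, hd, hxP⟩ := h
  choose u v huv hmin using fun i => (hP i).exists_bottleneck
  have hr : ∀ i, r i ≤ N.wt (u i) (v i) := fun i => by
    have hadj := (huv i).adj (hP i).2.2.2
    rw [wt, if_pos hadj]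
    refine le_trans ?_ (hx.2.1 _ _ hadj)
    rw [hxP]
    refine le_trans ?_ (Finset.single_le_sum (fun j _ => Nat.zero_le _) (Finset.mem_univ i))
    rw [pathFlow, if_pos (huv i)]
  have hval : N.value x = ∑ i, r i := by
    rw [value, Finset.sum_congr rfl fun w _ => hxP N.s w, Finset.sum_comm]
    exact Finset.sum_congr rfl fun i _ => (hP i).sum_pathFlow_source _
  -- Superfluous pebbles get the pair `(s, s)`, which is no arc of an acyclic network and so has
  -- threshold `0`.
  let a : Fin p → V × V := fun i => if h : i < k then (u ⟨i, h⟩, v ⟨i, h⟩) else (N.s, N.s)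
  have ha : ∀ i : Fin p, N.wt (a i).1 (a i).2 ≠ 0 → (i : ℕ) < k := fun i hi => by
    by_contra hik
    exact hi (by simp [a, hik, hN.wt_self])
  have ha' : ∀ (i : Fin p) (hi : (i : ℕ) < k), a i = (u ⟨i, hi⟩, v ⟨i, hi⟩) := fun i hi => by
    simp [a, hi]
  choose K hK using fun i => (hP i).eq_cons
  refine ⟨a, ⟨fun i => if h : (i : ℕ) < k then K ⟨i, h⟩ else [], fun i hi => ?_,
    fun i j hij hi hj b hb c hc hbc => ?_, ?_⟩, ?_⟩
  · have hik := ha i hi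
    simp only [ha' i hik, hik, dite_true]
    refine route_of_isChain (fun u' v' h' => hmin _ _ _ ?_) ?_
    · rwa [hK]
    · rw [← hK]
      exact (hP _).2.1
  · have hik := ha i hi
    have hjk := ha j hj
    simp only [hik, hjk, dite_true] at hb hc
    -- The fictitious starting arc `(s, s)` never conflicts, because its head is `s`.
    have hb' := (isArcOf_of_mem_arcsFrom hb).resolve_left
      (by rintro rfl; exact hbc.2.1 rfl)
    have hc' := (isArcOf_of_mem_arcsFrom hc).resolve_left
      (by rintro rfl; exact hbc.symm.2.1 rfl)
    have hap := hd ⟨i, hik⟩ ⟨j, hjk⟩ (by simpa [Fin.ext_iff] using hij)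
    rw [hK ⟨i, hik⟩, hK ⟨j, hjk⟩] at hap
    obtain ⟨h1, h2, h3 | ⟨hm, h3⟩⟩ := hbc
    · exact hap.1 _ _ ⟨hb', h1 ▸ h3 ▸ hc'⟩
    · rcases hap.2 hm _ hb'.mem_right (h1 ▸ hc'.mem_right) with h | h
      · exact h2 h
      · exact h3 h
  -- A route lists distinct vertices, so it has at most `Fintype.card V` moves.
  · refine (Finset.sum_le_card_nsmul _ _ (Fintype.card V) fun i _ => ?_).trans (by simp)
    by_cases hik : (i : ℕ) < k
    · simp only [hik, dite_true]
      have := (hP ⟨i, hik⟩).2.2.1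
      rw [hK] at this
      exact (List.nodup_cons.1 this).2.length_le_card
    · simp [hik]
  · rw [hval]
    calc ∑ i, r i ≤ ∑ i, N.wt (u i) (v i) := Finset.sum_le_sum fun i _ => hr i
      _ = ∑ i : Fin k, N.wt (a (Fin.castLE hk i)).1 (a (Fin.castLE hk i)).2 :=
          Finset.sum_congr rfl fun i _ => by simp [a]
      _ = ∑ i ∈ Finset.univ.map (Fin.castLEEmb hk), N.wt (a i).1 (a i).2 := by simp
      _ ≤ _ := Finset.sum_le_sum_of_subset (Finset.subset_univ _)

end FlowNetwork

/-! ## Numbers as configurations of the game -/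

namespace FlowNetwork

/-- The digit number `i` of `c` in base `b`. -/
def digit (b c i : ℕ) : ℕ := c / b ^ i % b

theorem digit_lt {b : ℕ} (hb : 0 < b) (c i : ℕ) : digit b c i < b := Nat.mod_lt _ hb

theorem exists_digits {b : ℕ} (p : ℕ) : ∀ g : ℕ → ℕ, (∀ i < p, g i < b) →
    ∃ c < b ^ p, ∀ i < p, digit b c i = g i := by
  induction p with
  | zero => exact fun _ _ => ⟨0, by simp⟩
  | succ p ih =>
    intro g hg
    obtain ⟨c, hc, h⟩ := ih (fun i => g (i + 1)) fun i hi => hg _ (by omega)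
    have h0 := hg 0 (by omega)
    refine ⟨g 0 + b * c, ?_, fun i hi => ?_⟩
    · calc g 0 + b * c < b * (c + 1) := by rw [mul_add]; omega
        _ ≤ b * b ^ p := Nat.mul_le_mul_left b hc
        _ = _ := by ring
    · cases i with
      | zero => simp [digit, Nat.mod_eq_of_lt h0]
      | succ i =>
        rw [← h i (by omega), digit, digit, pow_succ', ← Nat.div_div_eq_div_mul,
          Nat.add_mul_div_left _ _ (by omega), Nat.div_eq_of_lt h0, zero_add]

/-- The base of the numeration of configurations: a digit consists of an arc, on which there is a
pebble, and of an arc whose capacity is the threshold for the pebble. -/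
def cbase (n : ℕ) : ℕ := n * n * (n * n)

theorem exists_digit {n u v k : ℕ} (hu : u < n) (hv : v < n) (hk : k < n * n) :
    ∃ q < cbase n, q / n % n = u ∧ q % n = v ∧ q / (n * n) = k := by
  have h1 : (v + n * (u + n * k)) / n = u + n * k := by
    rw [Nat.add_mul_div_left _ _ (by omega), Nat.div_eq_of_lt hv, zero_add]
  refine ⟨v + n * (u + n * k), ?_, ?_, ?_, ?_⟩
  · have h2 : u + n * k < n * (k + 1) := by rw [mul_add]; omega
    calc v + n * (u + n * k) < n * (u + n * k + 1) := by rw [Nat.mul_add_one]; omega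
      _ ≤ n * (n * (k + 1)) := Nat.mul_le_mul_left n h2
      _ = n * n * (k + 1) := by ring
      _ ≤ _ := Nat.mul_le_mul_left _ hk
  · rw [h1, Nat.add_mul_mod_self_left, Nat.mod_eq_of_lt hu]
  · rw [Nat.add_mul_mod_self_left, Nat.mod_eq_of_lt hv]
  · rw [← Nat.div_div_eq_div_mul, h1, Nat.add_mul_div_left _ _ (by omega), Nat.div_eq_of_lt hu,
      zero_add]

/-! ### The game on numbered configurations. -/

section

variable {n : ℕ} (N : FlowNetwork (Fin n))

theorem capEntry_eq (u v : Fin n) : N.capEntry u v = N.wt u v := by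
  simp [capEntry, wt]

theorem capEntry_eq_zero {u v : ℕ} (h : n ≤ u) : N.capEntry u v = 0 :=
  dif_neg fun h' => by omega

/-- The arc of the pebble with state `q`. -/
def arcAt (q : ℕ) : Fin n × Fin n :=
  (⟨q / n % n, Nat.mod_lt _ N.s.pos⟩, ⟨q % n, Nat.mod_lt _ N.s.pos⟩)

/-- The threshold of the pebble with state `q`. -/
noncomputable def thrAt (q : ℕ) : ℕ := N.capEntry (q / (n * n) / n) (q / (n * n) % n)

theorem thrAt_congr {q q' : ℕ} (h : q / (n * n) = q' / (n * n)) : N.thrAt q = N.thrAt q' := by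
  rw [thrAt, thrAt, h]

/-- The numerical version of `Conflict`. -/
def ConflictAt (m : Prop) (q q' : ℕ) : Prop :=
  q % n = q' % n ∧ q % n ≠ N.s ∧ (q / n % n = q' / n % n ∨ (m ∧ q % n ≠ N.t))

theorem conflictAt_iff {m : Prop} {q q' : ℕ} :
    N.ConflictAt m q q' ↔ N.Conflict m (N.arcAt q) (N.arcAt q') := by
  simp [ConflictAt, Conflict, arcAt, Fin.ext_iff]

/-- There is no conflict between different pebbles of the configuration `c`. -/
def NoConflict (m : Prop) (p c : ℕ) : Prop :=
  ∀ i < p, ∀ j < p, i = j ∨ ¬ (N.thrAt (digit (cbase n) c i) ≠ 0 ∧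
    N.thrAt (digit (cbase n) c j) ≠ 0 ∧
    N.ConflictAt m (digit (cbase n) c i) (digit (cbase n) c j))

/-- Each pebble of the configuration `c` that is not ignored and not at the sink has a move to a
configuration in `S`. -/
def HasMoves (p : ℕ) (S : ℕ → Prop) (c : ℕ) : Prop :=
  ∀ i < p, ¬ N.thrAt (digit (cbase n) c i) ≠ 0 ∨ (digit (cbase n) c i % n = N.t ∨
    ∃ c' < cbase n ^ p, (∀ j < p, i = j ∨ digit (cbase n) c' j = digit (cbase n) c j) ∧
      digit (cbase n) c' i / n % n = digit (cbase n) c i % n ∧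
      digit (cbase n) c' i / (n * n) = digit (cbase n) c i / (n * n) ∧
      N.thrAt (digit (cbase n) c i) ≤
        N.capEntry (digit (cbase n) c' i / n % n) (digit (cbase n) c' i % n) ∧ S c')

/-- The configuration `c` is won in at most `k` moves. -/
def Won (m : Prop) (p c k : ℕ) : Prop :=
  N.Routable m (fun i : Fin p => N.arcAt (digit (cbase n) c i))
    (fun i : Fin p => N.thrAt (digit (cbase n) c i)) k

variable {N} {m : Prop} {p c : ℕ}

/-- The number of moves may depend on the successor `c'`. No uniform bound is needed, so the marks
may be updated in place. -/
theorem exists_won (hN : N.Acyclic) {S : ℕ → Prop}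
    (hS : ∀ c' < cbase n ^ p, S c' → ∃ k, N.Won m p c' k) (hc : N.NoConflict m p c)
    (hm : N.HasMoves p S c) : ∃ k, N.Won m p c k := by
  refine exists_routable_of_moves hN (fun i j hij hi hj h => ?_) fun i hi ht => ?_
  · rcases hc i i.2 j j.2 with h' | h'
    · exact hij (Fin.ext h')
    · exact h' ⟨hi, hj, N.conflictAt_iff.2 h⟩
  · rcases hm i i.2 with h | h | ⟨c', hc', h1, h2, h3, h4, h5⟩
    · exact absurd hi h
    · exact absurd (Fin.ext h) ht
    · have hv : (N.arcAt (digit (cbase n) c' i)).1 = (N.arcAt (digit (cbase n) c i)).2 :=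
        Fin.ext h2
      refine ⟨(N.arcAt (digit (cbase n) c' i)).2, ?_, ?_⟩
      · rw [← hv, ← capEntry_eq]
        exact h4
      · obtain ⟨k, hk⟩ := hS c' hc' h5
        refine ⟨k, ?_⟩
        have hthr : (fun i : Fin p => N.thrAt (digit (cbase n) c' i)) =
            fun i : Fin p => N.thrAt (digit (cbase n) c i) := by
          funext j
          rcases h1 j j.2 with h | h
          · obtain rfl := Fin.ext h
            exact N.thrAt_congr h3
          · simp only [h]
        have harc : (fun i : Fin p => N.arcAt (digit (cbase n) c' i)) =
            Function.update (fun i : Fin p => N.arcAt (digit (cbase n) c i)) i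
              ((N.arcAt (digit (cbase n) c i)).2, (N.arcAt (digit (cbase n) c' i)).2) := by
          funext j
          rcases eq_or_ne j i with rfl | hji
          · rw [Function.update_self, ← hv]
          · rw [Function.update_of_ne hji]
            rcases h1 j j.2 with h | h
            · exact absurd (Fin.ext h.symm) hji
            · simp only [h]
        rw [Won, hthr, harc] at hk
        exact hk

theorem Won.noConflict {k : ℕ} (h : N.Won m p c k) : N.NoConflict m p c := by
  refine fun i hi j hj => or_iff_not_imp_left.2 fun hij ⟨h1, h2, h3⟩ => ?_
  exact h.not_conflict (i := ⟨i, hi⟩) (j := ⟨j, hj⟩) (by simpa using hij) h1 h2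
    (N.conflictAt_iff.1 h3)

theorem thrAt_lt {q : ℕ} (hq : q < cbase n) : q / (n * n) < n * n :=
  Nat.div_lt_of_lt_mul hq

theorem Won.hasMoves {k : ℕ} (h : N.Won m p c k) {S : ℕ → Prop}
    (hS : 0 < k → ∀ c' < cbase n ^ p, N.Won m p c' (k - 1) → S c') : N.HasMoves p S c := by
  have hn : 0 < n := N.s.pos
  have hb : 0 < cbase n := by unfold cbase; positivity
  refine fun i hi => or_iff_not_imp_left.2 fun h0 => or_iff_not_imp_left.2 fun ht => ?_
  obtain ⟨hk, v, hv, hR⟩ := h.exists_move (i := ⟨i, hi⟩) (not_not.1 h0)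
    (fun h' => ht (congrArg Fin.val h'))
  obtain ⟨q, hq, hq1, hq2, hq3⟩ := exists_digit (n := n) (u := digit (cbase n) c i % n) (v := v)
    (k := digit (cbase n) c i / (n * n)) (Nat.mod_lt _ hn) v.2 (thrAt_lt (digit_lt hb _ _))
  -- The successor changes the digit `i` only: the old head becomes the tail, and the threshold
  -- index stays.
  obtain ⟨c', hc', h'⟩ := exists_digits (b := cbase n) p
    (fun j => if j = i then q else digit (cbase n) c j)
    (fun j _ => by split_ifs; exacts [hq, digit_lt hb _ _])
  have hi' : digit (cbase n) c' i = q := by simpa using h' i hi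
  refine ⟨c', hc', fun j hj => or_iff_not_imp_left.2 fun hij => ?_, ?_, ?_, ?_, hS hk c' hc' ?_⟩
  · rw [h' j hj, if_neg (Ne.symm hij)]
  · rw [hi', hq1]
  · rw [hi', hq3]
  · rw [hi', hq1, hq2]
    exact hv.trans_eq (N.capEntry_eq _ _).symm
  · unfold Won
    convert hR using 1
    · funext j
      rcases eq_or_ne j ⟨i, hi⟩ with rfl | hji
      · rw [Function.update_self]
        simp only [hi']
        exact Prod.ext (Fin.ext hq1) (Fin.ext hq2)
      · rw [Function.update_of_ne hji, h' j j.2, if_neg (by simpa [Fin.ext_iff] using hji)]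
    · funext j
      rcases eq_or_ne j ⟨i, hi⟩ with rfl | hji
      · exact N.thrAt_congr (by simp only [hi', hq3])
      · rw [h' j j.2, if_neg (by simpa [Fin.ext_iff] using hji)]

/-- All pebbles of the configuration `c` that are not ignored are at the source. -/
def AtSource (N : FlowNetwork (Fin n)) (p c : ℕ) : Prop :=
  ∀ i < p, ¬ N.thrAt (digit (cbase n) c i) ≠ 0 ∨ digit (cbase n) c i % n = N.s

/-- The sum of the thresholds. -/
noncomputable def total (N : FlowNetwork (Fin n)) (p c : ℕ) : ℕ :=
  ∑ i ∈ Finset.range p, N.thrAt (digit (cbase n) c i)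

theorem Won.exists_flow (hN : N.Acyclic) {k : ℕ} (h : N.Won m p c k) (hs : N.AtSource p c) :
    ∃ x, N.IsFlow x ∧ N.DecomposesInto (N.Apart m) p x ∧ N.value x = N.total p c := by
  rw [total, Finset.sum_range]
  exact Routable.exists_flow hN h fun i hi => Fin.ext ((hs i i.2).resolve_left (not_not.2 hi))

/-- All pebbles start on `(s, s)`; the threshold arc is stored as its offset in the row-by-row
capacity matrix. -/
theorem DecomposesInto.exists_won (hN : N.Acyclic) {x : Fin n → Fin n → ℕ} (hx : N.IsFlow x)
    (h : N.DecomposesInto (N.Apart m) p x) : ∃ c < cbase n ^ p, N.Won m p c (p * n) ∧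
      N.AtSource p c ∧ N.value x ≤ N.total p c := by
  have hn : 0 < n := N.s.pos
  obtain ⟨a, h1, h2⟩ := h.exists_routable hN hx
  rw [Fintype.card_fin] at h1
  have hq : ∀ i : Fin p, ∃ q < cbase n, q / n % n = N.s ∧ q % n = N.s ∧
      q / (n * n) = (a i).2 + n * (a i).1 := fun i => by
    refine exists_digit N.s.2 N.s.2 ?_
    calc ((a i).2 : ℕ) + n * (a i).1 < n * ((a i).1 + 1) := by
          rw [mul_add]; have := (a i).2.2; omega
      _ ≤ _ := Nat.mul_le_mul_left n (a i).1.2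
  choose q hq0 hq1 hq2 hq3 using hq
  obtain ⟨c, hc, hd⟩ := exists_digits (b := cbase n) p
    (fun i => if h : i < p then q ⟨i, h⟩ else 0)
    (fun i hi => by simpa only [hi, dite_true] using hq0 _)
  have hd' : ∀ i : Fin p, digit (cbase n) c i = q i := fun i => by simpa using hd i i.2
  have hthr : ∀ i : Fin p, N.thrAt (digit (cbase n) c i) = N.wt (a i).1 (a i).2 := fun i => by
    rw [thrAt, hd', hq3, Nat.add_mul_mod_self_left, Nat.mod_eq_of_lt (a i).2.2,
      Nat.add_mul_div_left _ _ hn, Nat.div_eq_of_lt (a i).2.2, zero_add, capEntry_eq]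
  have harc : ∀ i : Fin p, N.arcAt (digit (cbase n) c i) = (N.s, N.s) := fun i => by
    rw [hd']
    exact Prod.ext (Fin.ext (hq1 i)) (Fin.ext (hq2 i))
  refine ⟨c, hc, ?_, fun i hi => .inr ?_, ?_⟩
  · simpa only [Won, hthr, harc] using h1
  · exact congrArg (fun a => (a.2 : ℕ)) (harc ⟨i, hi⟩)
  · rw [total, Finset.sum_range]
    simpa only [hthr] using h2

open Classical in
/-- The maximum of the totals of the winning configurations in which all pebbles are at the
source is the maximum value of a decomposable flow. -/
theorem isGreatest_sup_total (hN : N.Acyclic) (S : ℕ → Prop)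
    (hS : ∀ c < cbase n ^ p, S c → ∃ k, N.Won m p c k)
    (hS' : ∀ c < cbase n ^ p, N.Won m p c (p * n) → S c) :
    IsGreatest {b | ∃ x, N.IsFlow x ∧ N.DecomposesInto (N.Apart m) p x ∧ N.value x = b}
      ((Finset.range (cbase n ^ p)).sup
        fun c => if S c ∧ N.AtSource p c then N.total p c else 0) := by
  have hn : 0 < n := N.s.pos
  have hb : 0 < cbase n ^ p := by unfold cbase; positivity
  constructor
  · obtain ⟨c, hc, h⟩ := Finset.exists_mem_eq_sup (Finset.range (cbase n ^ p)) ⟨0, by simpa⟩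
      (fun c => if S c ∧ N.AtSource p c then N.total p c else 0)
    rw [h]
    split_ifs with h'
    · obtain ⟨k, hk⟩ := hS c (Finset.mem_range.1 hc) h'.1
      exact hk.exists_flow hN h'.2
    -- The default `0` of the supremum is attained by the empty family of paths.
    · simpa using exists_flow_of_paths (N := N) (m := m) (p := p) (ι := Fin 0) (by simp)
        (fun _ => []) (fun _ => 0) (fun i => i.elim0) (fun i => i.elim0) (fun i => i.elim0)
  · rintro b ⟨x, hx, hd, rfl⟩
    obtain ⟨c, hc, h1, h2, h3⟩ := hd.exists_won hN hx
    refine h3.trans ?_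
    have := Finset.le_sup (f := fun c => if S c ∧ N.AtSource p c then N.total p c else 0)
      (Finset.mem_range.2 hc)
    simpa only [hS' c hc h1, h2, and_self, if_true] using this

end

end FlowNetwork

/-! ## The program -/

/-- The variables for `n * n`, for the base and for the number of configurations. The variables
`0, 1, 2, 3` hold `n`, `p`, `s`, `t`. -/
structure PebbleVars where
  sq : ℕ
  base : ℕ
  num : ℕ

namespace PebbleVars

open RAM

variable (w : PebbleVars)

def digitC (c i : ℕ) : Code := mod (div (var c) (pow (var w.base) (var i))) (var w.base)

def headC (q : ℕ) : Code := mod (var q) (var 0)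

def tailC (q : ℕ) : Code := mod (div (var q) (var 0)) (var 0)

def idxC (q : ℕ) : Code := div (var q) (var w.sq)

def thrC (q : ℕ) : Code := load (add (var w.sq) (w.idxC q))

def capC (q : ℕ) : Code := load (add (var w.sq) (add (mul (tailC q) (var 0)) (headC q)))

def conflictC (mode : Code) (q q' : ℕ) : Code :=
  and (eq (headC q) (headC q')) (and (not (eq (headC q) (var 2)))
    (or (eq (tailC q) (tailC q')) (and mode (not (eq (headC q) (var 3))))))

def noConflictC (mode : Code) (c : ℕ) : Code :=
  all 1 fun i => all 1 fun j => or (eq (var i) (var j))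
    (bind (w.digitC c i) fun q => bind (w.digitC c j) fun q' =>
      not (and (w.thrC q) (and (w.thrC q') (conflictC mode q q'))))

/-- The cells from `2 * n ^ 2` on follow the two input matrices and are `0` at the start, so the
marks need no initialization. -/
def markC (c : ℕ) : Code := add (add (var w.sq) (var w.sq)) (var c)

/-- Instead of computing the number of a successor, all configurations are searched for one with the
right digits. -/
def hasMovesC (c : ℕ) : Code :=
  all 1 fun i => bind (w.digitC c i) fun q => or (not (w.thrC q)) (or (eq (headC q) (var 3))
    (any w.num fun c' => and (all 1 fun j => or (eq (var i) (var j))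
      (eq (w.digitC c' j) (w.digitC c j)))
      (bind (w.digitC c' i) fun q' => and (eq (tailC q') (headC q))
        (and (eq (w.idxC q') (w.idxC q)) (and (le (w.thrC q) (w.capC q'))
          (load (w.markC c')))))))

def roundC (mode : Code) : Code := loop w.num (cst 0) fun _ c =>
  ite (and (w.noConflictC mode c) (w.hasMovesC c)) (store (w.markC c) (cst 1)) (cst 0)

def atSourceC (c : ℕ) : Code :=
  all 1 fun i => bind (w.digitC c i) fun q => or (not (w.thrC q)) (eq (headC q) (var 2))

def resultC : Code := max w.num fun c => ite (and (load (w.markC c)) (w.atSourceC c))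
  (sum 1 fun i => bind (w.digitC c i) fun q => w.thrC q) (cst 0)

end PebbleVars

namespace FlowNetwork

open RAM PebbleVars

/-- The memory `μ` still holds the capacities. -/
def Holds {n : ℕ} (N : FlowNetwork (Fin n)) (μ : ℕ → ℕ) : Prop :=
  ∀ k < n * n, μ (n * n + k) = N.capEntry (k / n) (k % n)

/-- The variables have their intended values. -/
structure Scope {n : ℕ} (N : FlowNetwork (Fin n)) (p : ℕ) (Γ : Ctx) (w : PebbleVars) : Prop where
  v_n : Var Γ 0 n
  v_p : Var Γ 1 p
  v_s : Var Γ 2 N.s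
  v_t : Var Γ 3 N.t
  v_sq : Var Γ w.sq (n * n)
  v_base : Var Γ w.base (cbase n)
  v_num : Var Γ w.num (cbase n ^ p)

/-- `M` is large enough to bound all loops. -/
structure Large (n p M : ℕ) : Prop where
  pos : 0 < n
  p_le : p ≤ M
  base_lt : cbase n < M
  num_lt : cbase n ^ p < M
  rounds : p * n + 1 ≤ M

/-! ### Correctness and cost of the program. -/

section

variable {n : ℕ} {N : FlowNetwork (Fin n)} {p M : ℕ} {Γ Δ : Ctx} {w : PebbleVars} {μ : ℕ → ℕ}
  {m : Prop} {mode : Code} {c i q q' vc vi vq vq' : ℕ}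

theorem Scope.mono (h : N.Scope p Γ w) (hΓ : Γ.Le Δ) : N.Scope p Δ w :=
  ⟨h.v_n.mono hΓ, h.v_p.mono hΓ, h.v_s.mono hΓ, h.v_t.mono hΓ, h.v_sq.mono hΓ, h.v_base.mono hΓ,
    h.v_num.mono hΓ⟩

theorem Large.cbase_pos (hM : Large n p M) : 0 < cbase n := by
  have := hM.pos
  unfold cbase
  positivity

theorem le_cbase (hn : 0 < n) : n * n ≤ cbase n := Nat.le_mul_of_pos_right _ (Nat.mul_pos hn hn)

theorem ev_digitC (hM : Large n p M) (h : N.Scope p Γ w) (hc : Var Γ c vc) (hi : Var Γ i vi)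
    (hc' : vc < cbase n ^ p) (hi' : vi < p) :
    Ev M Γ μ (w.digitC c i) (digit (cbase n) vc vi) 136 := by
  have hb := hM.cbase_pos
  have h1 : cbase n ^ vi ≤ M := (Nat.pow_le_pow_right hb hi'.le).trans hM.num_lt.le
  have h2 : vc < M := hc'.trans hM.num_lt
  exact Ev.cost_le (Ev.mod (Ev.div hc.ev (Ev.pow h.v_base.ev hi.ev hb
    (hi'.le.trans hM.p_le) h1) h2 (pow_pos hb _)) h.v_base.ev
    ((Nat.div_le_self _ _).trans h2.le) hb) (by omega)

theorem ev_headC (hM : Large n p M) (h : N.Scope p Γ w) (hq : Var Γ q vq) (hq' : vq < cbase n) :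
    Ev M Γ μ (headC q) (vq % n) 42 :=
  Ev.cost_le (Ev.mod hq.ev h.v_n.ev (hq'.trans hM.base_lt).le hM.pos) (by omega)

theorem ev_tailC (hM : Large n p M) (h : N.Scope p Γ w) (hq : Var Γ q vq) (hq' : vq < cbase n) :
    Ev M Γ μ (tailC q) (vq / n % n) 103 :=
  have hlt := hq'.trans hM.base_lt
  Ev.cost_le (Ev.mod (Ev.div hq.ev h.v_n.ev hlt hM.pos) h.v_n.ev
    ((Nat.div_le_self _ _).trans hlt.le) hM.pos) (by omega)

theorem ev_idxC (hM : Large n p M) (h : N.Scope p Γ w) (hq : Var Γ q vq) (hq' : vq < cbase n) :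
    Ev M Γ μ (w.idxC q) (vq / (n * n)) 62 :=
  Ev.cost_le (Ev.div hq.ev h.v_sq.ev (hq'.trans hM.base_lt) (Nat.mul_pos hM.pos hM.pos)) (by omega)

theorem ev_thrC (hM : Large n p M) (h : N.Scope p Γ w) (hμ : N.Holds μ) (hq : Var Γ q vq)
    (hq' : vq < cbase n) : Ev M Γ μ (w.thrC q) (N.thrAt vq) 69 := by
  have := Ev.load (h.v_sq.ev.add (ev_idxC (μ := μ) hM h hq hq'))
  rw [hμ _ (thrAt_lt hq')] at this
  exact this.cost_le (by omega)

theorem ev_capC (hM : Large n p M) (h : N.Scope p Γ w) (hμ : N.Holds μ) (hq : Var Γ q vq)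
    (hq' : vq < cbase n) : Ev M Γ μ (w.capC q) (N.capEntry (vq / n % n) (vq % n)) 175 := by
  have hn := hM.pos
  have ht : vq / n % n < n := Nat.mod_lt _ hn
  have hh : vq % n < n := Nat.mod_lt _ hn
  have hlt : vq / n % n * n + vq % n < n * n := by nlinarith
  have hle := le_cbase hn
  have := Ev.load (h.v_sq.ev.add (((ev_tailC (μ := μ) hM h hq hq').mul h.v_n.ev (by
    have := hM.base_lt
    nlinarith)).add (ev_headC hM h hq hq')))
  rw [hμ _ hlt] at this
  rw [show (vq / n % n * n + vq % n) / n = vq / n % n by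
    rw [add_comm, Nat.add_mul_div_right _ _ hn, Nat.div_eq_of_lt hh, zero_add],
    show (vq / n % n * n + vq % n) % n = vq % n by
      rw [add_comm, Nat.add_mul_mod_self_right, Nat.mod_mod]] at this
  exact this.cost_le (by omega)

theorem dec_conflictC (hM : Large n p M) (h : N.Scope p Γ w)
    (hmode : ∀ Γ μ, Dec M Γ μ mode m 0) (hq : Var Γ q vq) (hvq : vq < cbase n)
    (hq' : Var Γ q' vq') (hvq' : vq' < cbase n) :
    Dec M Γ μ (conflictC mode q q') (N.ConflictAt m vq vq') 970 :=
  have h1 := fun q vq (hq : Var Γ q vq) hvq => ev_headC (μ := μ) hM h hq hvq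
  have h2 := fun q vq (hq : Var Γ q vq) hvq => ev_tailC (μ := μ) hM h hq hvq
  Dec.cost_le ((Dec.eq (h1 q vq hq hvq) (h1 q' vq' hq' hvq')).and fun _ =>
    ((Dec.eq (h1 q vq hq hvq) h.v_s.ev).not.and fun _ =>
      ((Dec.eq (h2 q vq hq hvq) (h2 q' vq' hq' hvq')).or fun _ => ((hmode Γ μ).and fun _ =>
        (Dec.eq (h1 q vq hq hvq) h.v_t.ev).not)))) (by omega)

theorem dec_noConflictC (hM : Large n p M) (h : N.Scope p Γ w) (hμ : N.Holds μ)
    (hmode : ∀ Γ μ, Dec M Γ μ mode m 0) (hc : Var Γ c vc) (hvc : vc < cbase n ^ p) :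
    Dec M Γ μ (w.noConflictC mode c) (N.NoConflict m p vc) 1600 := by
  have hb := hM.cbase_pos
  refine Dec.cost_le (k := 1500 + 13 + 13) (Dec.all h.v_p hM.p_le fun Δ hΔ i vi hvi hi =>
    Dec.all (h.v_p.mono hΔ) hM.p_le fun Θ hΘ j vj hvj hj => ?_) (by omega)
  have hs := (h.mono hΔ).mono hΘ
  have hi := hi.mono hΘ
  have hc := (hc.mono hΔ).mono hΘ
  refine Dec.cost_le ((Dec.eq hi.ev hj.ev).or fun _ => Dec.bind
    (ev_digitC hM hs hc hi hvc hvi) (l := 1300) fun Λ hΛ q hq => Dec.cost_le (Dec.bind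
    (ev_digitC hM (hs.mono hΛ) (hc.mono hΛ) (hj.mono hΛ) hvc hvj) (l := 1140)
      fun Ξ hΞ q' hq' => ?_) (by omega)) (by omega)
  have hs := (hs.mono hΛ).mono hΞ
  have hq := hq.mono hΞ
  exact Dec.cost_le ((ev_thrC hM hs hμ hq (digit_lt hb _ _)).dec.and fun _ =>
    ((ev_thrC hM hs hμ hq' (digit_lt hb _ _)).dec.and fun _ =>
      dec_conflictC hM hs hmode hq (digit_lt hb _ _) hq' (digit_lt hb _ _))).not (by omega)

theorem ev_markC (h : N.Scope p Γ w) (hc : Var Γ c vc) :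
    Ev M Γ μ (w.markC c) (n * n + n * n + vc) 11 :=
  Ev.cost_le ((h.v_sq.ev.add h.v_sq.ev).add hc.ev) (by omega)

theorem dec_hasMovesC (hM : Large n p M) (h : N.Scope p Γ w) (hμ : N.Holds μ)
    (hc : Var Γ c vc) (hvc : vc < cbase n ^ p) :
    Dec M Γ μ (w.hasMovesC c) (N.HasMoves p (fun c' => μ (n * n + n * n + c') ≠ 0) vc) 3000 := by
  have hb := hM.cbase_pos
  refine Dec.cost_le (k := 2800 + 13) (Dec.all h.v_p hM.p_le fun Δ hΔ i vi hvi hi => ?_) (by omega)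
  have hs := h.mono hΔ
  have hc := hc.mono hΔ
  refine Dec.cost_le (Dec.bind (ev_digitC hM hs hc hi hvc hvi) (l := 2600) fun Θ hΘ q hq => ?_)
    (by omega)
  have hs := hs.mono hΘ
  have hc := hc.mono hΘ
  have hi := hi.mono hΘ
  have hvq := digit_lt hb vc vi
  refine Dec.cost_le ((ev_thrC hM hs hμ hq hvq).dec.not.or fun _ =>
    (Dec.eq (ev_headC hM hs hq hvq) hs.v_t.ev).or fun _ => Dec.any hs.v_num hM.num_lt.le (k := 2300)
      fun Λ hΛ c' vc' hvc' hc' => ?_) (by omega)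
  have hs := hs.mono hΛ
  have hc := hc.mono hΛ
  have hi := hi.mono hΛ
  have hq := hq.mono hΛ
  refine Dec.cost_le ((Dec.all hs.v_p hM.p_le (k := 650) fun Ξ hΞ j vj hvj hj => ?_).and fun _ =>
    Dec.bind (ev_digitC hM hs hc' hi hvc' hvi) (l := 1200) fun Ξ hΞ q' hq' => ?_) (by omega)
  · have hs := hs.mono hΞ
    exact Dec.cost_le ((Dec.eq (hi.mono hΞ).ev hj.ev).or fun _ =>
      Dec.eq (ev_digitC hM hs (hc'.mono hΞ) hj hvc' hvj)
        (ev_digitC hM hs (hc.mono hΞ) hj hvc hvj)) (by omega)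
  · have hs := hs.mono hΞ
    have hq := hq.mono hΞ
    have hvq' := digit_lt hb vc' vi
    exact Dec.cost_le ((Dec.eq (ev_tailC hM hs hq' hvq') (ev_headC hM hs hq hvq)).and fun _ =>
      (Dec.eq (ev_idxC hM hs hq' hvq') (ev_idxC hM hs hq hvq)).and fun _ =>
      (Dec.le (ev_thrC hM hs hμ hq hvq) (ev_capC hM hs hμ hq' hvq')).and fun _ =>
      (ev_markC hs (hc'.mono hΞ)).load.dec) (by omega)

/-- The marked configurations are winning, and among them are all those that are won in less
than `j` moves. -/
structure Marked (N : FlowNetwork (Fin n)) (m : Prop) (p j : ℕ) (μ : ℕ → ℕ) : Prop where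
  holds : N.Holds μ
  won : ∀ c < cbase n ^ p, μ (n * n + n * n + c) ≠ 0 → ∃ k, N.Won m p c k
  mark : ∀ c < cbase n ^ p, ∀ k < j, N.Won m p c k → μ (n * n + n * n + c) ≠ 0

/-- Soundness: marks are set only by the two local tests, which imply winning once all marked
successors are winning. Completeness: a configuration won in `j` moves has, for each pebble to be
moved, a successor won in `j - 1` moves, which was marked before the round. -/
theorem meets_roundC (hN : N.Acyclic) (hM : Large n p M) (h : N.Scope p Γ w)
    (hmode : ∀ Γ μ, Dec M Γ μ mode m 0) {j : ℕ} (hμ : N.Marked m p j μ) :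
    Meets M Γ μ (w.roundC mode) (fun _ μ' => N.Marked m p (j + 1) μ') 4700 := by
  refine Meets.imp (Meets.cost_le (k := 0 + 4650 + 8) (Meets.loop
    -- The counter descends, so the configurations from `i` on have been treated.
    (fun i _ μ' => N.Marked m p j μ' ∧ ∀ c < cbase n ^ p, i ≤ c → ∀ k ≤ j,
      N.Won m p c k → μ' (n * n + n * n + c) ≠ 0) h.v_num hM.num_lt.le
    (Meets.imp (Ev.cst 0) ?_) fun Δ hΔ _ c i _ μ' hi _ hc hI => ?_) (by omega)) ?_
  · rintro _ _ ⟨-, rfl⟩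
    exact ⟨hμ, fun c hc hc' => by omega⟩
  · obtain ⟨hμ', hI⟩ := hI
    have hs := h.mono hΔ
    refine Meets.cost_le (Meets.ite ((dec_noConflictC hM hs hμ'.holds hmode hc hi).and fun _ =>
      dec_hasMovesC hM hs hμ'.holds hc hi) (fun hw => Meets.imp
      (Meets.store (ev_markC hs hc) (Ev.cst 1)) ?_) fun hw => Meets.imp (Ev.cst 0) ?_) (by omega)
    · rintro _ ν rfl
      have hmark : ∀ c', μ' (n * n + n * n + c') ≠ 0 →
          Function.update μ' (n * n + n * n + i) 1 (n * n + n * n + c') ≠ 0 := fun c' hc' => by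
        rw [Function.update_apply]
        split_ifs
        · exact one_ne_zero
        · exact hc'
      refine ⟨⟨fun k hk => ?_, fun c' hc' h' => ?_, fun c' hc' k hk h' =>
        hmark c' (hμ'.mark c' hc' k hk h')⟩, fun c' hc' hic k hk h' => ?_⟩
      -- The marks lie behind the capacity matrix, so the capacities survive.
      · rw [Function.update_of_ne (by omega)]
        exact hμ'.holds k hk
      · rcases eq_or_ne c' i with rfl | hne
        · exact exists_won hN hμ'.won hw.1 hw.2
        · rw [Function.update_of_ne (by omega)] at h'
          exact hμ'.won c' hc' h'
      · rcases hic.eq_or_lt with rfl | hic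
        · simp
        · exact hmark c' (hI c' hc' hic k hk h')
    · rintro _ ν ⟨-, rfl⟩
      refine ⟨hμ', fun c' hc' hic k hk h' => ?_⟩
      rcases hic.eq_or_lt with rfl | hic
      -- A configuration that fails a test cannot be won in at most `j` moves.
      · refine absurd ⟨h'.noConflict, h'.hasMoves fun hk0 c'' hc'' h'' => ?_⟩ hw
        exact hμ'.mark c'' hc'' _ (by omega) h''
      · exact hI c' hc' hic k hk h'
  · rintro _ μ' ⟨h1, h2⟩
    exact ⟨h1.holds, h1.won, fun c hc k hk => h2 c hc (Nat.zero_le _) k (by omega)⟩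

theorem dec_atSourceC (hM : Large n p M) (h : N.Scope p Γ w) (hμ : N.Holds μ)
    (hc : Var Γ c vc) (hvc : vc < cbase n ^ p) :
    Dec M Γ μ (w.atSourceC c) (N.AtSource p vc) 400 := by
  have hb := hM.cbase_pos
  refine Dec.cost_le (Dec.all h.v_p hM.p_le (k := 350) fun Δ hΔ i vi hvi hi => Dec.cost_le (Dec.bind
    (ev_digitC hM (h.mono hΔ) (hc.mono hΔ) hi hvc hvi) (l := 200) fun Θ hΘ q hq => ?_)
    (by omega)) (by omega)
  have hs := (h.mono hΔ).mono hΘ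
  exact Dec.cost_le ((ev_thrC hM hs hμ hq (digit_lt hb _ _)).dec.not.or fun _ =>
    Dec.eq (ev_headC hM hs hq (digit_lt hb _ _)) hs.v_s.ev) (by omega)

open Classical in
theorem ev_resultC (hM : Large n p M) (h : N.Scope p Γ w) (hμ : N.Holds μ) :
    Ev M Γ μ w.resultC ((Finset.range (cbase n ^ p)).sup fun c =>
      if μ (n * n + n * n + c) ≠ 0 ∧ N.AtSource p c then N.total p c else 0) 1000 := by
  have hb := hM.cbase_pos
  refine Ev.cost_le (Ev.max h.v_num hM.num_lt.le (k := 900) fun Δ hΔ c vc hvc hc => ?_) (by omega)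
  have hs := h.mono hΔ
  have hd := (ev_markC (M := M) (μ := μ) hs hc).load.dec.and fun _ => dec_atSourceC hM hs hμ hc hvc
  refine Ev.cost_le (Meets.ite hd (k := 300) (l := 0) (fun hP => ?_) fun hP => ?_) (by omega)
  · rw [if_pos hP]
    refine Ev.cost_le (Ev.sum hs.v_p hM.p_le (k := 210) fun Θ hΘ i vi hvi hi => ?_) (by omega)
    exact Ev.cost_le (Ev.bind (ev_digitC hM (hs.mono hΘ) (hc.mono hΘ) hi hvc hvi)
      fun Λ hΛ q hq => ev_thrC hM ((hs.mono hΘ).mono hΛ) hμ hq (digit_lt hb _ _)) (by omega)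
  · rw [if_neg hP]
    exact Ev.cst 0

end

/-- The algorithm, for vertex-disjoint paths if `mode` is `tt` and for arc-disjoint paths if it
is `ff`: compute `n * n`, the base and the number of configurations, mark the winning
configurations in `p * n + 1` rounds, and compute the maximum total. -/
def solveC (mode : Code) : Code :=
  bind (mul (var 0) (var 0)) fun sq => bind (mul (var sq) (var sq)) fun base =>
    bind (pow (var base) (var 1)) fun num => bind (add (mul (var 1) (var 0)) (cst 1)) fun r =>
      bind (loop r (cst 0) fun _ _ => roundC ⟨sq, base, num⟩ mode) fun _ =>
        resultC ⟨sq, base, num⟩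

/-- A cell behind the capacity matrix would belong to a row with index at least `n`, where the
entries are `0`: nothing is marked yet. -/
theorem marked_zero {n : ℕ} (N : FlowNetwork (Fin n)) (m : Prop) (p : ℕ) :
    N.Marked m p 0 (N.initialState p).mem := by
  have hn : 0 < n := N.s.pos
  refine ⟨fun k hk => ?_, fun c _ h => absurd ?_ h, by simp⟩
  · simp [initialState]
  · simp only [initialState, show ¬ n * n + n * n + c < n * n by omega, if_false]
    refine N.capEntry_eq_zero ((Nat.le_div_iff_mul_le hn).2 ?_)
    omega

theorem meets_solveC {n : ℕ} {N : FlowNetwork (Fin n)} (hN : N.Acyclic) {m : Prop} {p M : ℕ}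
    (hM : Large n p M) {mode : Code} (hmode : ∀ Γ μ, Dec M Γ μ mode m 0) :
    Meets M ⟨4, (N.initialState p).reg⟩ (N.initialState p).mem (solveC mode)
      (fun a _ => IsGreatest
        {b | ∃ x, N.IsFlow x ∧ N.DecomposesInto (N.Apart m) p x ∧ N.value x = b} a) 6000 := by
  have hn := hM.pos
  have hb := hM.cbase_pos
  have hle := le_cbase hn
  have hle' : n ≤ n * n := Nat.le_mul_of_pos_left n hn
  have hlt := hM.base_lt
  have hp := hM.p_le
  set Γ : Ctx := ⟨4, (N.initialState p).reg⟩
  have v0 : Var Γ 0 n := ⟨by simp [Γ], by simp [Γ, initialState]⟩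
  have v1 : Var Γ 1 p := ⟨by simp [Γ], by simp [Γ, initialState]⟩
  have v2 : Var Γ 2 N.s := ⟨by simp [Γ], by simp [Γ, initialState]⟩
  have v3 : Var Γ 3 N.t := ⟨by simp [Γ], by simp [Γ, initialState]⟩
  refine Meets.cost_le (Ev.bind (v0.ev.mul v0.ev (by omega)) (l := 5900) fun Δ hΔ sq hsq =>
    Meets.cost_le (Ev.bind (hsq.ev.mul hsq.ev (by omega)) (l := 5850) fun Θ hΘ base hbase =>
    Meets.cost_le (Ev.bind (hbase.ev.pow ((v1.mono hΔ).mono hΘ).ev hb hp hM.num_lt.le)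
      (l := 5800) fun Λ hΛ num hnum => ?_) (by omega)) (by omega)) (by omega)
  have hΛ' := (hΔ.trans hΘ).trans hΛ
  have hs : N.Scope p Λ ⟨sq, base, num⟩ := ⟨v0.mono hΛ', v1.mono hΛ', v2.mono hΛ', v3.mono hΛ',
    (hsq.mono hΘ).mono hΛ, hbase.mono hΛ, hnum⟩
  refine Meets.cost_le (Ev.bind ((hs.v_p.ev.mul hs.v_n.ev hp).add (Ev.cst 1)) (l := 5750)
    fun Ξ hΞ r hr => ?_) (by omega)
  have hs := hs.mono hΞ
  refine Meets.cost_le (Meets.bind (Meets.loop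
    -- `j` counts the completed rounds; after `p * n + 1` of them everything won in at most `p * n`
    -- moves is marked.
    (fun i _ μ => ∃ j, j + i = p * n + 1 ∧ N.Marked m p j μ) hr hM.rounds (k := 0)
    (Meets.imp (Ev.cst 0) ?_) ?_) (l := 1000) fun Υ hΥ _ _ μ _ hμ => ?_)
    (k := 0 + 4700 + 8 + 1000 + 2) (by omega)
  · rintro _ _ ⟨-, rfl⟩
    exact ⟨0, by omega, N.marked_zero m p⟩
  · rintro Υ hΥ _ _ i _ μ _ _ _ ⟨j, hj, hμ⟩
    refine Meets.imp (meets_roundC hN hM (hs.mono hΥ) hmode hμ) fun _ μ' hμ' =>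
      ⟨j + 1, by omega, hμ'⟩
  · obtain ⟨j, hj, hμ⟩ := hμ
    refine Meets.imp (ev_resultC hM (hs.mono hΥ) hμ.holds) ?_
    rintro _ _ ⟨rfl, -⟩
    convert isGreatest_sup_total hN (fun c => μ (n * n + n * n + c) ≠ 0) hμ.won
      fun c hc h => hμ.mark c hc _ (by omega) h

/-! ### From the loop bound to an exponent in `n`. -/

theorem large_pow {n : ℕ} (hn : 2 ≤ n) (p : ℕ) : Large n p (n ^ (4 * p + 5)) := by
  have hp : p < n ^ p := Nat.lt_pow_self (by omega)
  have h0 : 1 ≤ n ^ p := Nat.one_le_pow _ _ (by omega)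
  have hc : cbase n = n ^ 4 := by unfold cbase; ring
  refine ⟨by omega, hp.le.trans (Nat.pow_le_pow_right (by omega) (by omega)), ?_, ?_, ?_⟩
  · rw [hc]
    exact Nat.pow_lt_pow_right (by omega) (by omega)
  · rw [hc, ← pow_mul]
    exact Nat.pow_lt_pow_right (by omega) (by omega)
  · calc p * n + 1 ≤ n ^ p * n := by nlinarith
      _ = n ^ (p + 1) := (pow_succ _ _).symm
      _ ≤ _ := Nat.pow_le_pow_right (by omega) (by omega)

/-- As `n ≥ 2`, additive constants can be absorbed by raising exponents. The bound becomes a pure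
power of `n`, with implied constant `1`. -/
theorem pow_add_two_pow_add_two_le {n k l : ℕ} (hn : 2 ≤ n) (hk : k ≠ 0) (hl : l ≠ 0) :
    (n ^ k + 2) ^ l + 2 ≤ n ^ ((k + 1) * (l + 1)) := by
  have h1 : 2 ≤ n ^ k := hn.trans (Nat.le_self_pow hk n)
  have h2 : n ^ k + 2 ≤ n ^ (k + 1) := by
    rw [pow_succ]
    nlinarith
  have h3 : 2 ≤ n ^ (k + 1) := by omega
  have h4 : 2 ≤ (n ^ (k + 1)) ^ l := h3.trans (Nat.le_self_pow hl _)
  calc (n ^ k + 2) ^ l + 2 ≤ (n ^ (k + 1)) ^ l + 2 :=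
        Nat.add_le_add_right (Nat.pow_le_pow_left h2 _) _
    _ ≤ (n ^ (k + 1)) ^ l * n ^ (k + 1) := by nlinarith
    _ = _ := by rw [← pow_succ, ← pow_mul]

theorem exists_solver (m : Prop) (mode : Code) (hmode : ∀ M Γ μ, Dec M Γ μ mode m 0)
    (R : ∀ n, FlowNetwork (Fin n) → List (Fin n) → List (Fin n) → Prop)
    (hR : ∀ n N P Q, R n N P Q ↔ N.Apart m P Q) :
    ∃ (A : Prog) (f : ℕ → ℕ) (C : ℕ), Computable f ∧
      SolvesOnAcyclic A (fun n N p a => IsGreatest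
        {b | ∃ x, N.IsFlow x ∧ N.DecomposesInto (R n N) p x ∧ N.value x = b} a)
        (fun n p => C * n ^ f p) := by
  obtain rfl : R = fun _ N => N.Apart m := by
    funext n N P Q
    exact propext (hR n N P Q)
  -- Level 4 protects the input in the registers 0 to 3. The exponent is `(k + 1) * (l + 1)` for `k
  -- = 4 * p + 5` and `l = 6000`; the final copy takes two more steps.
  refine ⟨.seq (solveC mode 4) (copy 0 4), fun p => (4 * p + 6) * 6001, 1, ?_, ?_⟩
  · exact (Primrec.nat_mul.comp (Primrec.nat_add.comp
      (Primrec.nat_mul.comp (Primrec.const 4) Primrec.id) (Primrec.const 6))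
      (Primrec.const 6001)).to_comp
  · intro n N p hN
    -- The source and the sink are different vertices.
    have hn : 2 ≤ n := by
      have := N.s_ne_t
      have h1 := N.s.2
      have h2 := N.t.2
      by_contra hn
      exact this (Fin.ext (by omega))
    obtain ⟨τ, k, h1, h2, -, h3⟩ := (meets_solveC hN (large_pow hn p) (hmode _)).run _
      (Ctx.Le.refl _)
    refine ⟨_, _, Runs.seq h1 (runs_copy (by omega) τ), ?_, by simpa [State.setReg] using h3⟩
    refine le_trans ?_ (one_mul (n ^ ((4 * p + 6) * 6001))).ge
    exact (Nat.add_le_add_right h2 2).trans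
      (pow_add_two_pow_add_two_le hn (by omega) (by omega))

end FlowNetwork

theorem mainTheorem3 :
    (∃ (A : RAM.Prog) (f : ℕ → ℕ) (C : ℕ), Computable f ∧
      SolvesOnAcyclic A (fun _ N p a => N.IsVertexDecomposableMax p a)
        (fun n p => C * n ^ f p)) ∧
    (∃ (A : RAM.Prog) (f : ℕ → ℕ) (C : ℕ), Computable f ∧
      SolvesOnAcyclic A (fun _ N p a => N.IsArcDecomposableMax p a)
        (fun n p => C * n ^ f p)) := by
  exact ⟨FlowNetwork.exists_solver True RAM.tt (fun _ _ _ => RAM.Dec.tt)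
      (fun _ N => N.VertexDisjoint)
      fun _ N P Q => by simp [FlowNetwork.VertexDisjoint, FlowNetwork.Apart],
    FlowNetwork.exists_solver False RAM.ff (fun _ _ _ => RAM.Dec.ff)
      (fun _ _ => FlowNetwork.ArcDisjoint) fun _ N P Q => by simp [FlowNetwork.Apart]⟩
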